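/- Let $X$ and $Y$ be compact Hausdorff spaces, let $\mu$, $\nu$ be finite (positive) regular Borel measures on $X$, $Y$, and put $H_1=L_2(X,\mu)$, $H_2=L_2(Y,\nu)$ (complex $L_2$-spaces). Let $V(X,Y)=C(X)\hat\otimes C(Y)$ be the Varopoulos algebra, that is, the set of all $F\in C(X\times Y)$ of the form $F(x,y)=\sum_{n=1}^\infty f_n(x)g_n(y)$ with $f_n\in C(X)$, $g_n\in C(Y)$ and $\sum_{n=1}^\infty\|f_n\|_{C(X)}\|g_n\|_{C(Y)}<\infty$. For such an $F$ and $T\in B(H_1,H_2)$ put $$F\cdot T=\Delta_F(T)=\sum_{n=1}^\infty M_{g_n}TM_{f_n},$$ where $M_f$, $M_g$ denote multiplication by $f$ on $H_1$ and by $g$ on $H_2$; the sum converges in norm and does not depend on the representation of $F$. Let $\mathrm{null}(F)=\{(x,y)\in X\times Y: F(x,y)=0\}$, and let $\mathrm{Supp}(T)$ be the intersection of the sets $\mathrm{null}(G)$ over all $G\in V(X,Y)$ with $G\cdot T=0$. Then, for every $F\in V(X,Y)$, the following conditions are equivalent: (a) $F$ is operator synthetic with respect to $(\mu,\nu)$: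 $F\cdot T=0$ for every $T\in B(H_1,H_2)$ with $\mathrm{Supp}(T)\subset\mathrm{null}(F)$; (b) the solution space $K_F=\{T\in B(H_1,H_2): F\cdot T=0\}$ is reflexive: every $A\in B(H_1,H_2)$ such that $Ax\in\overline{K_Fx}$ for all $x\in H_1$ belongs to $K_F$; (c) $\ker\Delta_F=\mathcal E_{\Delta_F}(0)$, where $\mathcal E_{\Delta_F}(0)=\{T\in B(H_1,H_2): \|\Delta_F^n(T)\|^{1/n}\to 0 \text{ as } n\to\infty\}$. -/

import Mathlib

open MeasureTheory Filter Topology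
open scoped ENNReal

namespace OpSynth

noncomputable section

/-- `f₀ ⊗ g₀ + f₁ ⊗ g₁ + ⋯` is a representation of `F` as an element of the projective tensor
product of `C(X)` and `C(Y)`. -/
def IsRep {X Y : Type*} [TopologicalSpace X] [CompactSpace X] [TopologicalSpace Y] [CompactSpace Y]
    (f : ℕ → C(X, ℂ)) (g : ℕ → C(Y, ℂ)) (F : C(X × Y, ℂ)) : Prop :=
  Summable (fun n => ‖f n‖ * ‖g n‖) ∧ ∀ x y, HasSum (fun n => f n x * g n y) (F (x, y))

/-- The Varopoulos algebra `V(X, Y)`: the continuous functions `F` on `X × Y` of the form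
`F(x, y) = ∑ fₙ(x) gₙ(y)` with `fₙ ∈ C(X)`, `gₙ ∈ C(Y)` and `∑ ‖fₙ‖ ‖gₙ‖ < ∞`. -/
def Varopoulos (X Y : Type*) [TopologicalSpace X] [CompactSpace X] [TopologicalSpace Y]
    [CompactSpace Y] : Type _ :=
  {F : C(X × Y, ℂ) // ∃ (f : ℕ → C(X, ℂ)) (g : ℕ → C(Y, ℂ)), IsRep f g F}

section MulOp

variable {X : Type*} [TopologicalSpace X] [CompactSpace X] [MeasurableSpace X] [BorelSpace X]

theorem memLp_mul (μ : Measure X) (f : C(X, ℂ)) (u : Lp ℂ 2 μ) :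
    MemLp (fun x => f x * u x) 2 μ := by
  refine MemLp.of_le_mul (c := ‖f‖) (Lp.memLp u)
    (f.continuous.aestronglyMeasurable.mul (Lp.aestronglyMeasurable u)) (ae_of_all _ fun x => ?_)
  rw [norm_mul]
  exact mul_le_mul_of_nonneg_right (f.norm_coe_le_norm x) (norm_nonneg _)

/-- The multiplication operator `M_f u = f u` on `L²(X, μ)`. -/
def mulOp (μ : Measure X) (f : C(X, ℂ)) : Lp ℂ 2 μ →L[ℂ] Lp ℂ 2 μ :=
  LinearMap.mkContinuous
    { toFun := fun u => (memLp_mul μ f u).toLp (fun x => f x * u x)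
      map_add' := fun u v => by
        rw [← MemLp.toLp_add]
        apply MemLp.toLp_congr
        filter_upwards [Lp.coeFn_add u v] with x hx
        simp only [hx, Pi.add_apply, mul_add]
      map_smul' := fun c u => by
        rw [RingHom.id_apply, ← MemLp.toLp_const_smul]
        apply MemLp.toLp_congr
        filter_upwards [Lp.coeFn_smul c u] with x hx
        simp only [hx, Pi.smul_apply, smul_eq_mul, mul_left_comm] }
    ‖f‖ fun u => by
      refine Lp.norm_le_mul_norm_of_ae_le_mul ?_
      filter_upwards [(memLp_mul μ f u).coeFn_toLp] with x hx
      simp only [LinearMap.coe_mk, AddHom.coe_mk]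
      rw [hx, norm_mul]
      exact mul_le_mul_of_nonneg_right (f.norm_coe_le_norm x) (norm_nonneg _)

theorem mulOp_ae (μ : Measure X) (f : C(X, ℂ)) (u : Lp ℂ 2 μ) :
    mulOp μ f u =ᵐ[μ] fun x => f x * u x :=
  (memLp_mul μ f u).coeFn_toLp

theorem norm_mulOp_le (μ : Measure X) (f : C(X, ℂ)) : ‖mulOp μ f‖ ≤ ‖f‖ :=
  LinearMap.mkContinuous_norm_le _ (norm_nonneg f) _

end MulOp

variable {X Y : Type*} [TopologicalSpace X] [CompactSpace X] [MeasurableSpace X] [BorelSpace X]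
  [TopologicalSpace Y] [CompactSpace Y] [MeasurableSpace Y] [BorelSpace Y]

/-- The elementary multiplication operator `T ↦ M_g T M_f` on `B(L²(X, μ), L²(Y, ν))`. -/
def elemOp (μ : Measure X) (ν : Measure Y) (f : C(X, ℂ)) (g : C(Y, ℂ)) :
    (Lp ℂ 2 μ →L[ℂ] Lp ℂ 2 ν) →L[ℂ] (Lp ℂ 2 μ →L[ℂ] Lp ℂ 2 ν) :=
  (ContinuousLinearMap.compL ℂ (Lp ℂ 2 μ) (Lp ℂ 2 ν) (Lp ℂ 2 ν) (mulOp ν g)).comp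
    ((ContinuousLinearMap.compL ℂ (Lp ℂ 2 μ) (Lp ℂ 2 μ) (Lp ℂ 2 ν)).flip (mulOp μ f))

theorem elemOp_apply (μ : Measure X) (ν : Measure Y) (f : C(X, ℂ)) (g : C(Y, ℂ))
    (T : Lp ℂ 2 μ →L[ℂ] Lp ℂ 2 ν) :
    elemOp μ ν f g T = (mulOp ν g).comp (T.comp (mulOp μ f)) := rfl

theorem norm_elemOp_le (μ : Measure X) (ν : Measure Y) (f : C(X, ℂ)) (g : C(Y, ℂ)) :
    ‖elemOp μ ν f g‖ ≤ ‖f‖ * ‖g‖ := by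
  refine ContinuousLinearMap.opNorm_le_bound _ (by positivity) fun T => ?_
  rw [elemOp_apply]
  calc ‖(mulOp ν g).comp (T.comp (mulOp μ f))‖
      ≤ ‖mulOp ν g‖ * (‖T‖ * ‖mulOp μ f‖) :=
        (ContinuousLinearMap.opNorm_comp_le _ _).trans
          (mul_le_mul_of_nonneg_left (ContinuousLinearMap.opNorm_comp_le _ _) (norm_nonneg _))
    _ ≤ ‖g‖ * (‖T‖ * ‖f‖) := by
        gcongr
        · exact norm_mulOp_le ν g
        · exact norm_mulOp_le μ f
    _ = ‖f‖ * ‖g‖ * ‖T‖ := by ring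

theorem summable_of_norm_le {E G : Type*} [NormedAddCommGroup E] [NormedSpace ℂ E]
    [NormedAddCommGroup G] [NormedSpace ℂ G] [CompleteSpace G]
    (A : ℕ → (E →L[ℂ] G)) (c : ℕ → ℝ) (hc : Summable c)
    (hA : ∀ n, ‖A n‖ ≤ c n) : Summable A :=
  Summable.of_norm_bounded hc hA

theorem summable_elemOp (μ : Measure X) (ν : Measure Y) {f : ℕ → C(X, ℂ)} {g : ℕ → C(Y, ℂ)}
    (h : Summable (fun n => ‖f n‖ * ‖g n‖)) : Summable (fun n => elemOp μ ν (f n) (g n)) :=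
  summable_of_norm_le (E := Lp ℂ 2 μ →L[ℂ] Lp ℂ 2 ν) (G := Lp ℂ 2 μ →L[ℂ] Lp ℂ 2 ν)
    (fun n => elemOp μ ν (f n) (g n))
    (fun n => ‖f n‖ * ‖g n‖) h (fun n => norm_elemOp_le μ ν (f n) (g n))

/-- The multiplication operator `Δ_F : T ↦ F · T = ∑ M_{gₙ} T M_{fₙ}` on
`B(L²(X, μ), L²(Y, ν))`, where `F = ∑ fₙ ⊗ gₙ`; a representation of `F` is chosen here, and
`hasSum_mulBy` shows that every other one gives the same operator. -/
def mulBy (μ : Measure X) (ν : Measure Y) (F : Varopoulos X Y) :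
    (Lp ℂ 2 μ →L[ℂ] Lp ℂ 2 ν) →L[ℂ] (Lp ℂ 2 μ →L[ℂ] Lp ℂ 2 ν) :=
  ∑' n, elemOp μ ν (F.2.choose n) (F.2.choose_spec.choose n)

/-- The set `null(F)` of zeros of `F`. -/
def nullSet (F : Varopoulos X Y) : Set (X × Y) := {p | F.1 p = 0}

/-- The annihilator of `T` in `V(X, Y)`. -/
def ann {μ : Measure X} {ν : Measure Y} (T : Lp ℂ 2 μ →L[ℂ] Lp ℂ 2 ν) : Set (Varopoulos X Y) :=
  {F | mulBy μ ν F T = 0}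

/-- The support of `T` as an element of the `V(X, Y)`-module `B(L²(X, μ), L²(Y, ν))`: the null set
of the annihilator of `T`. -/
def moduleSupp {μ : Measure X} {ν : Measure Y} (T : Lp ℂ 2 μ →L[ℂ] Lp ℂ 2 ν) : Set (X × Y) :=
  ⋂ F ∈ ann T, nullSet F

/-- `F` is operator synthetic with respect to `(μ, ν)`: `F · T = 0` for every operator `T` whose
support is contained in the null set of `F`. -/
def IsOperatorSynthetic (μ : Measure X) (ν : Measure Y) (F : Varopoulos X Y) : Prop :=
  ∀ T : Lp ℂ 2 μ →L[ℂ] Lp ℂ 2 ν, moduleSupp T ⊆ nullSet F → mulBy μ ν F T = 0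

/-- The space of solutions `T` of the operator equation `F · T = 0`. -/
def solutionSpace (μ : Measure X) (ν : Measure Y) (F : Varopoulos X Y) :
    Submodule ℂ (Lp ℂ 2 μ →L[ℂ] Lp ℂ 2 ν) :=
  LinearMap.ker (mulBy μ ν F).toLinearMap

/-- The `0`-spectral subspace `{z | ‖D ^ n z‖ ^ (1 / n) → 0}` of a bounded operator `D`. -/
def zeroSpectralSubspace {E : Type*} [NormedAddCommGroup E] [NormedSpace ℂ E] (D : E →L[ℂ] E) :
    Set E :=
  {z | Tendsto (fun n : ℕ => ‖(D ^ n) z‖ ^ (1 / (n : ℝ))) atTop (𝓝 0)}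

/-- The reflexive hull of a space `L` of operators: all `A` such that `A x` lies in the closure of
`L x` for every vector `x`. -/
def refHull {E G : Type*} [NormedAddCommGroup E] [NormedSpace ℂ E] [NormedAddCommGroup G]
    [NormedSpace ℂ G] (L : Submodule ℂ (E →L[ℂ] G)) : Set (E →L[ℂ] G) :=
  {A | ∀ x : E, A x ∈ closure ((fun S : E →L[ℂ] G => S x) '' (L : Set (E →L[ℂ] G)))}

/-- A space of operators is reflexive if it equals its reflexive hull. -/
def IsReflexive {E G : Type*} [NormedAddCommGroup E] [NormedSpace ℂ E] [NormedAddCommGroup G]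
    [NormedSpace ℂ G] (L : Submodule ℂ (E →L[ℂ] G)) : Prop :=
  refHull L = (L : Set (E →L[ℂ] G))

/-! The operator `F · T` does not depend on the representation of `F`. -/

theorem hasSum_integral_mul (μ : Measure X) {f : ℕ → C(X, ℂ)} {c : ℕ → ℂ} {a h : X → ℂ}
    (ha : Integrable a μ) (hs : Summable (fun n => ‖f n‖ * ‖c n‖))
    (hh : ∀ x, HasSum (fun n => c n * f n x) (h x)) :
    HasSum (fun n => c n * ∫ x, f n x * a x ∂μ) (∫ x, h x * a x ∂μ) := by
  have hint : ∀ n, Integrable (fun x => c n * (f n x * a x)) μ := fun n =>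
    ((ha.bdd_mul (c := ‖f n‖) (f n).continuous.aestronglyMeasurable
      (ae_of_all _ fun x => (f n).norm_coe_le_norm x))).const_mul _
  have key := hasSum_integral_of_summable_integral_norm (μ := μ)
    (F := fun n x => c n * (f n x * a x)) hint ?_
  · have e : (fun x => ∑' n, c n * (f n x * a x)) = fun x => h x * a x := by
      funext x
      simpa [mul_assoc] using ((hh x).mul_right (a x)).tsum_eq
    rw [e] at key
    simpa only [integral_const_mul] using key
  · refine Summable.of_nonneg_of_le (fun n => by positivity) (fun n => ?_)
      (hs.mul_right (∫ x, ‖a x‖ ∂μ))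
    rw [← integral_const_mul]
    refine integral_mono (hint n).norm (ha.norm.const_mul _) fun x => ?_
    simp only [norm_mul]
    have := mul_le_mul_of_nonneg_right ((f n).norm_coe_le_norm x)
      (mul_nonneg (norm_nonneg (c n)) (norm_nonneg (a x)))
    linarith

theorem inner_elemOp_rankOne (μ : Measure X) (ν : Measure Y) (f : C(X, ℂ)) (g : C(Y, ℂ))
    (a u : Lp ℂ 2 μ) (b v : Lp ℂ 2 ν) :
    inner ℂ v (elemOp μ ν f g (InnerProductSpace.rankOne ℂ b a) u) =
      (∫ x, f x * (u x * star (a x)) ∂μ) * ∫ y, g y * (b y * star (v y)) ∂ν := by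
  rw [elemOp_apply, ContinuousLinearMap.comp_apply, ContinuousLinearMap.comp_apply,
    InnerProductSpace.rankOne_apply, map_smul, inner_smul_right, L2.inner_def, L2.inner_def]
  congr 1
  · refine integral_congr_ae ?_
    filter_upwards [mulOp_ae μ f u] with x hx
    simp only [hx, RCLike.inner_apply, starRingEnd_apply, mul_assoc]
  · refine integral_congr_ae ?_
    filter_upwards [mulOp_ae ν g b] with x hx
    simp only [hx, RCLike.inner_apply, starRingEnd_apply, mul_assoc]

theorem integrable_mul_star {Z : Type*} [MeasurableSpace Z] (μ : Measure Z) (u a : Lp ℂ 2 μ) :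
    Integrable (fun x => u x * star (a x)) μ := by
  simpa only [RCLike.inner_apply, starRingEnd_apply] using L2.integrable_inner (𝕜 := ℂ) a u

theorem hasSum_rankOne (μ : Measure X) (ν : Measure Y) {f : ℕ → C(X, ℂ)} {g : ℕ → C(Y, ℂ)}
    {F : C(X × Y, ℂ)} (h : IsRep f g F) (a u : Lp ℂ 2 μ) (b v : Lp ℂ 2 ν) :
    HasSum (fun n => inner ℂ v (elemOp μ ν (f n) (g n) (InnerProductSpace.rankOne ℂ b a) u))
      (∫ y, (∫ x, F (x, y) * (u x * star (a x)) ∂μ) * (b y * star (v y)) ∂ν) := by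
  simp only [inner_elemOp_rankOne]
  have hu := integrable_mul_star μ u a
  refine hasSum_integral_mul ν (integrable_mul_star ν b v) ?_ fun y => ?_
  · refine Summable.of_nonneg_of_le (fun n => by positivity) (fun n => ?_)
      (h.1.mul_right (∫ x, ‖u x * star (a x)‖ ∂μ))
    have hn : ‖∫ x, f n x * (u x * star (a x)) ∂μ‖ ≤ ‖f n‖ * ∫ x, ‖u x * star (a x)‖ ∂μ := by
      rw [← integral_const_mul]
      refine norm_integral_le_of_norm_le (hu.norm.const_mul _) (ae_of_all _ fun x => ?_)
      rw [norm_mul]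
      exact mul_le_mul_of_nonneg_right ((f n).norm_coe_le_norm x) (norm_nonneg _)
    nlinarith [mul_le_mul_of_nonneg_left hn (norm_nonneg (g n))]
  · have := hasSum_integral_mul μ (c := fun n => g n y) (f := f) (h := fun x => F (x, y)) hu ?_ ?_
    · simpa only [mul_comm] using this
    · exact Summable.of_nonneg_of_le (fun n => by positivity)
        (fun n => mul_le_mul_of_nonneg_left ((g n).norm_coe_le_norm y) (norm_nonneg _)) h.1
    · intro x
      simpa only [mul_comm] using h.2 x y

theorem tendsto_tsum_elemOp (μ : Measure X) (ν : Measure Y) {f : ℕ → C(X, ℂ)} {g : ℕ → C(Y, ℂ)}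
    (h : Summable (fun n => ‖f n‖ * ‖g n‖)) (T : Lp ℂ 2 μ →L[ℂ] Lp ℂ 2 ν)
    (u : Lp ℂ 2 μ) (v : Lp ℂ 2 ν) :
    Tendsto (fun s : Finset (Lp ℂ 2 μ) => ∑' n, (inner ℂ v (elemOp μ ν (f n) (g n)
        (T.comp (Submodule.span ℂ (s : Set (Lp ℂ 2 μ))).starProjection) u) : ℂ)) atTop
      (𝓝 (∑' n, inner ℂ v (elemOp μ ν (f n) (g n) T u))) := by
  refine tendsto_tsum_of_dominated_convergence (bound := fun n => ‖v‖ * (‖f n‖ * ‖g n‖ * ‖T‖ * ‖u‖))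
    (((h.mul_right ‖T‖).mul_right ‖u‖).mul_left ‖v‖) (fun n => ?_) (Eventually.of_forall ?_)
  · have hP := Submodule.starProjection_tendsto_self (𝕜 := ℂ)
      (fun s : Finset (Lp ℂ 2 μ) => Submodule.span ℂ (s : Set (Lp ℂ 2 μ)))
      (fun s t hst => Submodule.span_mono (by exact_mod_cast hst)) (mulOp μ (f n) u) ?_
    · simp only [elemOp_apply, ContinuousLinearMap.comp_apply]
      exact (tendsto_const_nhds.inner (((mulOp ν (g n)).continuous.comp T.continuous).tendsto _
        |>.comp hP))
    · refine le_trans (fun x _ => ?_) (Submodule.le_topologicalClosure _)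
      exact Submodule.mem_iSup_of_mem {x} (Submodule.subset_span (by simp))
  · intro s n
    refine (norm_inner_le_norm _ _).trans (mul_le_mul_of_nonneg_left ?_ (norm_nonneg _))
    refine (ContinuousLinearMap.le_opNorm _ _).trans
      (mul_le_mul_of_nonneg_right ?_ (norm_nonneg _))
    refine (ContinuousLinearMap.le_opNorm _ _).trans ?_
    refine mul_le_mul (norm_elemOp_le μ ν _ _) ?_ (norm_nonneg _) (by positivity)
    refine (ContinuousLinearMap.opNorm_comp_le _ _).trans ?_
    exact mul_le_of_le_one_right (norm_nonneg _) (Submodule.starProjection_norm_le _)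

theorem tsum_elemOp_eq (μ : Measure X) (ν : Measure Y) {f f' : ℕ → C(X, ℂ)} {g g' : ℕ → C(Y, ℂ)}
    {F : C(X × Y, ℂ)} (h : IsRep f g F) (h' : IsRep f' g' F) :
    ∑' n, elemOp μ ν (f n) (g n) = ∑' n, elemOp μ ν (f' n) (g' n) := by
  have ev : ∀ {f : ℕ → C(X, ℂ)} {g : ℕ → C(Y, ℂ)}, Summable (fun n => ‖f n‖ * ‖g n‖) →
      ∀ (T : Lp ℂ 2 μ →L[ℂ] Lp ℂ 2 ν) (u : Lp ℂ 2 μ) (v : Lp ℂ 2 ν),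
      HasSum (fun n => inner ℂ v (elemOp μ ν (f n) (g n) T u))
        (inner ℂ v ((∑' n, elemOp μ ν (f n) (g n)) T u)) := fun hs T u v =>
    (((summable_elemOp μ ν hs).hasSum.mapL (ContinuousLinearMap.apply ℂ _ T)).mapL
      (ContinuousLinearMap.apply ℂ _ u)).mapL (innerSL ℂ v)
  refine ContinuousLinearMap.ext fun T => ContinuousLinearMap.ext fun u =>
    ext_inner_left ℂ fun v => ?_
  rw [← (ev h.1 T u v).tsum_eq, ← (ev h'.1 T u v).tsum_eq]
  refine tendsto_nhds_unique (tendsto_tsum_elemOp μ ν h.1 T u v) ?_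
  refine (tendsto_tsum_elemOp μ ν h'.1 T u v).congr fun s => ?_
  rw [(ev h'.1 _ u v).tsum_eq, (ev h.1 _ u v).tsum_eq,
    (stdOrthonormalBasis ℂ (Submodule.span ℂ (s : Set (Lp ℂ 2 μ)))).starProjection_eq_sum_rankOne]
  have hc : ∀ e : Lp ℂ 2 μ, T.comp (InnerProductSpace.rankOne ℂ e e) =
      InnerProductSpace.rankOne ℂ (T e) e := fun e => by
    ext1 w
    simp [InnerProductSpace.rankOne_apply]
  rw [ContinuousLinearMap.comp_finsetSum]
  simp only [hc, map_sum, _root_.sum_apply, inner_sum]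
  refine Finset.sum_congr rfl fun i _ => ?_
  exact ((ev h'.1 _ u v).unique (hasSum_rankOne μ ν h' _ u _ v)).trans
    ((ev h.1 _ u v).unique (hasSum_rankOne μ ν h _ u _ v)).symm

/-- `Δ_F = ∑ M_{gₙ} (·) M_{fₙ}` in operator norm, for every representation `F = ∑ fₙ ⊗ gₙ`. -/
theorem hasSum_mulBy (μ : Measure X) (ν : Measure Y) (F : Varopoulos X Y) {f : ℕ → C(X, ℂ)}
    {g : ℕ → C(Y, ℂ)} (h : IsRep f g F.1) :
    HasSum (fun n => elemOp μ ν (f n) (g n)) (mulBy μ ν F) := by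
  rw [mulBy, tsum_elemOp_eq μ ν F.2.choose_spec.choose_spec h]
  exact (summable_elemOp μ ν h.1).hasSum

end

end OpSynth

/-!
Write `D = Δ_F` and `N = null(F)`. All three conditions compare `ker D` with the space of operators
`T` whose support lies in `N`. The kernel is contained in that space, condition (a) is the reverse
inclusion, and the proof shows that both the `0`-spectral subspace of `D`
(`mem_zeroSpectralSubspace_iff`) and the reflexive hull of `ker D` (`mem_refHull_iff`) are equal to
that space.

*Local form.* Near a point `p` the operator `D` is `F(p) + R` with `R` of small norm, on the range
of an elementary operator `T ↦ M_g T M_f` with `f ⊗ g = 1` near `p` (`exists_local_form`). If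
`F(p) ≠ 0`, then `D` is bounded below there, so that this elementary operator kills the spectral
subspace of `D`, and hence `ker D` and its reflexive hull (`exists_elemOp_eq_zero`). It follows that
every operator in either of these spaces has its support in `N`. If `F(p) = 0`, then the powers of
`D` decay there faster than any given geometric rate. Away from its support `T` is locally killed by
elementary operators, and on `N` the second case applies; a compactness argument on rectangles
(`exists_compr_of_local`) puts the pieces together, so that `T` lies in the spectral subspace if its
support lies in `N`.

*Reflexive hull.* Let the support of `T` lie in `N`, and let `v` be orthogonal to `(ker D) u`; the
claim is `⟨T u, v⟩ = 0`. A measure `σ` on a compact part of `N` whose marginals are dominated by `μ`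
and `ν`, together with a bounded density, defines a pseudo-integral operator, which `F` annihilates
(`mulBy_pairOp_eq_zero`). Choosing the density so that `⟨S u, v⟩ = ∫ |u ⊗ v| dσ` shows that there is
no such `σ ≠ 0` on a compact part of `N` where `u ⊗ v` has no zeros
(`measure_eq_zero_of_orthogonal`). By duality (`exists_measure_of_coverCost`, which combines
Hahn–Banach with the Riesz representation theorem) the function `1` can then be majorized on this
part of `N` by `a(x) + b(y)` with `a, b ≥ 0` continuous and `∫ a dμ + ∫ b dν` as small as desired.
Removing the sets where `a` or `b` exceeds `1/3` leaves compact sets `K`, `L` that carry almost all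
of `u` and `v` and have `K × L` disjoint from `N` (`exists_isCompact_of_orthogonal`). An operator
vanishes on compact rectangles that miss its support, which gives `⟨T u, v⟩ = 0` in the limit.
-/

namespace OpSynth

noncomputable section

/-! ### Perturbations of scalars and the `0`-spectral subspace -/

section BoundedOperators

variable {E : Type*} [NormedAddCommGroup E] [NormedSpace ℂ E]

theorem commute_of_hasSum {a : ℕ → E →L[ℂ] E} {D A : E →L[ℂ] E} (h : HasSum a D)
    (hA : ∀ n, Commute (a n) A) : Commute D A := by
  refine (h.mul_right A).unique ?_
  simp only [fun n => (hA n).eq]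
  exact h.mul_left A

theorem norm_sub_smul_one_mul_le {a P B C : E →L[ℂ] E} {c : ℂ} {β γ : ℝ}
    (h : a * P = B + (C + c • P)) (hB : ‖B‖ ≤ β) (hC : ‖C‖ ≤ γ) :
    ‖(a - c • 1) * P‖ ≤ β + γ := by
  rw [sub_mul, smul_mul_assoc, one_mul, h, ← add_assoc, add_sub_cancel_right]
  exact (norm_add_le _ _).trans (add_le_add hB hC)

theorem norm_hasSum_sub_smul_one_mul_le {a : ℕ → E →L[ℂ] E} {D P : E →L[ℂ] E} {s : ℕ → ℂ} {c : ℂ}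
    {t : ℕ → ℝ} (ha : HasSum a D) (hs : HasSum s c) (ht : Summable t)
    (h : ∀ n, ‖(a n - s n • 1) * P‖ ≤ t n) : ‖(D - c • 1) * P‖ ≤ ∑' n, t n := by
  have hsum : HasSum (fun n => (a n - s n • 1) * P) ((D - c • 1) * P) :=
    (ha.sub (hs.smul_const 1)).mul_right _
  rw [← hsum.tsum_eq]
  exact tsum_of_norm_bounded ht.hasSum h

/-- If `P` is the identity on the range of `A`, then on that range the powers of `D` are those of
`c + (D - c) P`, which is a small perturbation of `c` when `(D - c) P` is small. -/
theorem pow_mul_eq_of_mul_eq {D A P : E →L[ℂ] E} (c : ℂ) (hPA : P * A = A) (hcomm : Commute P A)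
    (hDA : Commute D A) (n : ℕ) : D ^ n * A = (c • 1 + (D - c • 1) * P) ^ n * A := by
  have hone : Commute (c • (1 : E →L[ℂ] E)) A := (Commute.one_left A).smul_left c
  have hQA : Commute (c • 1 + (D - c • 1) * P) A :=
    hone.add_left ((hDA.sub_left hone).mul_left hcomm)
  have h1 : D * A = (c • 1 + (D - c • 1) * P) * A := by
    rw [add_mul, mul_assoc, hPA, sub_mul, add_sub_cancel]
  induction n with
  | zero => simp
  | succ n ih => rw [pow_succ, mul_assoc, h1, hQA.eq, ← mul_assoc, ih, mul_assoc, ← hQA.eq,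
      ← mul_assoc, ← pow_succ]

theorem mul_norm_le_norm_smul_one_add_pow (c : ℂ) (R : E →L[ℂ] E) (hR : ‖R‖ ≤ ‖c‖) (n : ℕ) (z : E) :
    (‖c‖ - ‖R‖) ^ n * ‖z‖ ≤ ‖((c • 1 + R) ^ n) z‖ := by
  induction n with
  | zero => simp
  | succ n ih =>
    rw [pow_succ', pow_succ', mul_assoc, mul_apply_eq_comp]
    set w := ((c • 1 + R) ^ n) z
    have h1 : (c • 1 + R) w = c • w + R w := by simp
    have h2 : ‖c • w‖ - ‖R w‖ ≤ ‖c • w + R w‖ := norm_sub_le_norm_add _ _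
    rw [h1]
    rw [norm_smul] at h2
    have := R.le_opNorm w
    nlinarith [mul_le_mul_of_nonneg_left ih (sub_nonneg.2 hR)]

theorem norm_smul_one_add_pow_le (c : ℂ) (R : E →L[ℂ] E) (n : ℕ) (z : E) :
    ‖((c • 1 + R) ^ n) z‖ ≤ (‖c‖ + ‖R‖) ^ n * ‖z‖ := by
  induction n with
  | zero => simp
  | succ n ih =>
    rw [pow_succ', pow_succ', mul_assoc, mul_apply_eq_comp]
    set w := ((c • 1 + R) ^ n) z
    have h1 : (c • 1 + R) w = c • w + R w := by simp
    have h2 : ‖c • w + R w‖ ≤ ‖c • w‖ + ‖R w‖ := norm_add_le _ _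
    rw [h1]
    rw [norm_smul] at h2
    have := R.le_opNorm w
    nlinarith [mul_le_mul_of_nonneg_left ih (add_nonneg (norm_nonneg c) (norm_nonneg R))]

/-- An operator that commutes with `D` and on whose range `D` is a small perturbation of a non-zero
scalar annihilates the `0`-spectral subspace of `D`. -/
theorem eq_zero_of_mem_zeroSpectralSubspace {D A R : E →L[ℂ] E} {c : ℂ} (hc : c ≠ 0)
    (hR : ‖R‖ ≤ ‖c‖ / 2) (hcomm : Commute D A) (h : ∀ n, D ^ n * A = (c • 1 + R) ^ n * A) {z : E}
    (hz : z ∈ zeroSpectralSubspace D) : A z = 0 := by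
  have hc0 : 0 < ‖c‖ := norm_pos_iff.2 hc
  have key : ∀ n : ℕ, (‖c‖ / 2) ^ n * ‖A z‖ ≤ ‖A‖ * ‖(D ^ n) z‖ := fun n => by
    calc (‖c‖ / 2) ^ n * ‖A z‖ ≤ (‖c‖ - ‖R‖) ^ n * ‖A z‖ := by
          gcongr; linarith
      _ ≤ ‖((c • 1 + R) ^ n) (A z)‖ :=
          mul_norm_le_norm_smul_one_add_pow c R (by linarith) n _
      _ = ‖A ((D ^ n) z)‖ := by
          rw [← mul_apply_eq_comp, ← mul_apply_eq_comp, ← h n, (hcomm.pow_left n).eq]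
      _ ≤ _ := A.le_opNorm _
  have hev : ∀ᶠ n : ℕ in atTop, ‖A z‖ ≤ ‖A‖ * (1 / 2) ^ n := by
    have h4 : (0 : ℝ) < ‖c‖ / 4 := by positivity
    filter_upwards [hz.eventually (gt_mem_nhds h4), eventually_ge_atTop 1] with n hn hn1
    have hn0 : n ≠ 0 := by omega
    have h5 : ‖(D ^ n) z‖ ≤ (‖c‖ / 4) ^ n := by
      calc ‖(D ^ n) z‖ = (‖(D ^ n) z‖ ^ (1 / (n : ℝ))) ^ n := by
            rw [one_div, Real.rpow_inv_natCast_pow (norm_nonneg _) hn0]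
        _ ≤ _ := by gcongr
    have h6 := (key n).trans (mul_le_mul_of_nonneg_left h5 (norm_nonneg _))
    have h7 : (‖c‖ / 4) ^ n = (‖c‖ / 2) ^ n * (1 / 2) ^ n := by rw [← mul_pow]; congr 1; ring
    rw [h7] at h6
    have h8 : 0 < (‖c‖ / 2) ^ n := by positivity
    exact le_of_mul_le_mul_left (by linarith) h8
  have hlim : Tendsto (fun n : ℕ => ‖A‖ * (1 / 2 : ℝ) ^ n) atTop (𝓝 (‖A‖ * 0)) :=
    (tendsto_pow_atTop_nhds_zero_of_lt_one (by norm_num) (by norm_num)).const_mul _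
  rw [mul_zero] at hlim
  exact norm_le_zero_iff.1 (ge_of_tendsto hlim hev)

theorem mem_zeroSpectralSubspace_of_apply_eq_zero (D : E →L[ℂ] E) {z : E} (hz : D z = 0) :
    z ∈ zeroSpectralSubspace D := by
  -- The term `n = 0` of the sequence is `1`, since the exponent `1 / 0` is `0`.
  refine tendsto_const_nhds.congr' ?_
  filter_upwards [eventually_ge_atTop 1] with n hn
  obtain ⟨k, rfl⟩ : ∃ k, n = k + 1 := ⟨n - 1, by omega⟩
  rw [pow_succ, mul_apply_eq_comp, hz, map_zero, norm_zero,
    Real.zero_rpow (by positivity)]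

end BoundedOperators

/-! ### Elementary operators and the local form of `Δ_F` -/

section LocalForm

section Multiplication

variable {X : Type*} [TopologicalSpace X] [CompactSpace X] [MeasurableSpace X] [BorelSpace X]

theorem mulOp_mul (μ : Measure X) (f g : C(X, ℂ)) :
    mulOp μ (f * g) = (mulOp μ f).comp (mulOp μ g) := by
  refine ContinuousLinearMap.ext fun u => Lp.ext ?_
  rw [ContinuousLinearMap.comp_apply]
  filter_upwards [mulOp_ae μ (f * g) u, mulOp_ae μ f (mulOp μ g u), mulOp_ae μ g u] with x h1 h2 h3
  rw [h1, h2, h3, ContinuousMap.mul_apply, mul_assoc]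

theorem mulOp_add (μ : Measure X) (f g : C(X, ℂ)) :
    mulOp μ (f + g) = mulOp μ f + mulOp μ g := by
  refine ContinuousLinearMap.ext fun u => Lp.ext ?_
  rw [_root_.add_apply]
  filter_upwards [mulOp_ae μ (f + g) u, mulOp_ae μ f u, mulOp_ae μ g u,
    Lp.coeFn_add (mulOp μ f u) (mulOp μ g u)] with x h1 h2 h3 h4
  rw [h1, h4, Pi.add_apply, h2, h3, ContinuousMap.add_apply, add_mul]

theorem mulOp_smul (μ : Measure X) (c : ℂ) (f : C(X, ℂ)) :
    mulOp μ (c • f) = c • mulOp μ f := by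
  refine ContinuousLinearMap.ext fun u => Lp.ext ?_
  rw [_root_.smul_apply]
  filter_upwards [mulOp_ae μ (c • f) u, mulOp_ae μ f u, Lp.coeFn_smul c (mulOp μ f u)]
    with x h1 h2 h3
  rw [h1, h3, Pi.smul_apply, h2, ContinuousMap.smul_apply, smul_eq_mul, smul_eq_mul, mul_assoc]

end Multiplication

variable {X Y : Type*} [TopologicalSpace X] [CompactSpace X] [MeasurableSpace X] [BorelSpace X]
  [TopologicalSpace Y] [CompactSpace Y] [MeasurableSpace Y] [BorelSpace Y]
  (μ : Measure X) (ν : Measure Y)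

theorem elemOp_mul (f f' : C(X, ℂ)) (g g' : C(Y, ℂ)) :
    elemOp μ ν (f * f') (g * g') = elemOp μ ν f g * elemOp μ ν f' g' := by
  refine ContinuousLinearMap.ext fun T => ContinuousLinearMap.ext fun u => ?_
  simp only [mul_apply_eq_comp, elemOp_apply, ContinuousLinearMap.comp_apply]
  rw [mul_comm f f', mulOp_mul, mulOp_mul]
  rfl

theorem commute_elemOp (f f' : C(X, ℂ)) (g g' : C(Y, ℂ)) :
    Commute (elemOp μ ν f g) (elemOp μ ν f' g') := by
  rw [Commute, SemiconjBy, ← elemOp_mul, ← elemOp_mul, mul_comm f, mul_comm g]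

theorem elemOp_add_left (f f' : C(X, ℂ)) (g : C(Y, ℂ)) :
    elemOp μ ν (f + f') g = elemOp μ ν f g + elemOp μ ν f' g := by
  refine ContinuousLinearMap.ext fun T => ContinuousLinearMap.ext fun u => ?_
  simp [elemOp_apply, mulOp_add]

theorem elemOp_add_right (f : C(X, ℂ)) (g g' : C(Y, ℂ)) :
    elemOp μ ν f (g + g') = elemOp μ ν f g + elemOp μ ν f g' := by
  refine ContinuousLinearMap.ext fun T => ContinuousLinearMap.ext fun u => ?_
  simp [elemOp_apply, mulOp_add]

theorem elemOp_smul_left (c : ℂ) (f : C(X, ℂ)) (g : C(Y, ℂ)) :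
    elemOp μ ν (c • f) g = c • elemOp μ ν f g := by
  refine ContinuousLinearMap.ext fun T => ContinuousLinearMap.ext fun u => ?_
  simp [elemOp_apply, mulOp_smul]

theorem elemOp_smul_right (c : ℂ) (f : C(X, ℂ)) (g : C(Y, ℂ)) :
    elemOp μ ν f (c • g) = c • elemOp μ ν f g := by
  refine ContinuousLinearMap.ext fun T => ContinuousLinearMap.ext fun u => ?_
  simp [elemOp_apply, mulOp_smul]

/-- Every operator that commutes with all elementary operators commutes with `Δ_F`. -/
theorem commute_mulBy (F : Varopoulos X Y)
    {A : (Lp ℂ 2 μ →L[ℂ] Lp ℂ 2 ν) →L[ℂ] (Lp ℂ 2 μ →L[ℂ] Lp ℂ 2 ν)}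
    (hA : ∀ f g, Commute (elemOp μ ν f g) A) : Commute (mulBy μ ν F) A := by
  exact commute_of_hasSum (E := Lp ℂ 2 μ →L[ℂ] Lp ℂ 2 ν)
    (hasSum_mulBy μ ν F F.2.choose_spec.choose_spec) fun n => hA _ _

omit [MeasurableSpace X] [BorelSpace X] [MeasurableSpace Y] [BorelSpace Y] in
theorem isRep_tensor (f : C(X, ℂ)) (g : C(Y, ℂ)) :
    IsRep (fun n => if n = 0 then f else 0) (fun n => if n = 0 then g else 0)
      (⟨fun p => f p.1 * g p.2, by fun_prop⟩ : C(X × Y, ℂ)) := by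
  refine ⟨summable_of_ne_finset_zero (s := {0}) fun n hn => by simp_all, fun x y => ?_⟩
  refine (hasSum_single (f := fun n : ℕ => (if n = 0 then f else 0 : C(X, ℂ)) x *
    (if n = 0 then g else 0 : C(Y, ℂ)) y) 0 fun n hn => ?_)
  simp [hn]

/-- The function `f ⊗ g` as an element of the Varopoulos algebra. -/
def tensor (f : C(X, ℂ)) (g : C(Y, ℂ)) : Varopoulos X Y :=
  ⟨⟨fun p => f p.1 * g p.2, by fun_prop⟩, _, _, isRep_tensor f g⟩

theorem mulBy_tensor (f : C(X, ℂ)) (g : C(Y, ℂ)) :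
    mulBy μ ν (tensor f g) = elemOp μ ν f g := by
  refine (hasSum_mulBy μ ν (tensor f g) (isRep_tensor f g)).unique ?_
  refine (hasSum_single (f := fun n : ℕ => elemOp μ ν (if n = 0 then f else 0 : C(X, ℂ))
    (if n = 0 then g else 0 : C(Y, ℂ))) 0 fun n hn => ?_)
  have h0 := elemOp_smul_left μ ν 0 0 (0 : C(Y, ℂ))
  rw [zero_smul] at h0
  rw [if_neg hn, if_neg hn]
  exact h0.trans (zero_smul ℂ (elemOp μ ν (0 : C(X, ℂ)) (0 : C(Y, ℂ))))

omit [MeasurableSpace X] [BorelSpace X] in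
/-- A point of a compact Hausdorff space has two nested cutoff functions supported in a given
neighbourhood: `χ` is `1` wherever `f` does not vanish, and `f` is `1` near the point. -/
theorem exists_cutoff [T2Space X] (x₀ : X) {O : Set X} (hO : O ∈ 𝓝 x₀) :
    ∃ χ f : C(X, ℂ), ‖χ‖ ≤ 1 ∧ (∀ x, x ∉ O → χ x = 0) ∧ χ * f = f ∧ ∀ᶠ x in 𝓝 x₀, f x = 1 := by
  obtain ⟨w, hw0, hw1, hw⟩ := exists_continuous_zero_one_of_isClosed
    (isClosed_compl_iff.2 isOpen_interior : IsClosed (interior O)ᶜ) (isClosed_singleton (x := x₀))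
    (Set.disjoint_singleton_right.2 fun h => h (mem_interior_iff_mem_nhds.2 hO))
  -- `f` vanishes where `w ≤ 1/3`, and `χ = 1` where `w ≥ 1/3`.
  refine ⟨⟨fun x => ((min 1 (3 * w x) : ℝ) : ℂ), by fun_prop⟩,
    ⟨fun x => ((min 1 (max 0 (3 * w x - 1)) : ℝ) : ℂ), by fun_prop⟩, ?_, ?_, ?_, ?_⟩
  · refine (ContinuousMap.norm_le _ zero_le_one).2 fun x => ?_
    simp only [ContinuousMap.coe_mk, Complex.norm_real, Real.norm_eq_abs]
    have := (hw x).1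
    rw [abs_of_nonneg (by positivity)]
    exact min_le_left _ _
  · intro x hx
    have : w x = 0 := hw0 fun h => hx (interior_subset h)
    simp [this]
  · ext x
    simp only [ContinuousMap.mul_apply, ContinuousMap.coe_mk, ← Complex.ofReal_mul]
    congr 1
    rcases le_total (3 * w x) 1 with h | h
    · rw [max_eq_left (by linarith)]; simp
    · rw [min_eq_left h, one_mul]
  · have h1 : w x₀ = 1 := hw1 rfl
    have : ∀ᶠ x in 𝓝 x₀, 2 / 3 < w x := by
      refine (w.continuous.tendsto x₀).eventually (lt_mem_nhds ?_)
      rw [h1]; norm_num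
    filter_upwards [this] with x hx
    simp only [ContinuousMap.coe_mk]
    rw [max_eq_right (by linarith), min_eq_left (by linarith), Complex.ofReal_one]

theorem norm_elemOp_sub_mul_le (f χ : C(X, ℂ)) (g ψ : C(Y, ℂ)) (hχ : ‖χ‖ ≤ 1) (hψ : ‖ψ‖ ≤ 1)
    (x₀ : X) (y₀ : Y) :
    ‖(elemOp μ ν f g - (f x₀ * g y₀) • 1) * elemOp μ ν χ ψ‖ ≤
      ‖(f - ContinuousMap.const X (f x₀)) * χ‖ * ‖g‖ +
        ‖f‖ * ‖(g - ContinuousMap.const Y (g y₀)) * ψ‖ := by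
  refine norm_sub_smul_one_mul_le (E := Lp ℂ 2 μ →L[ℂ] Lp ℂ 2 ν)
    (B := elemOp μ ν ((f - ContinuousMap.const X (f x₀)) * χ) (g * ψ))
    (C := elemOp μ ν (f x₀ • χ) ((g - ContinuousMap.const Y (g y₀)) * ψ)) ?_ ?_ ?_
  · have h1 : f * χ = (f - ContinuousMap.const X (f x₀)) * χ + f x₀ • χ := by
      ext x; simp [sub_mul]
    have h2 : g * ψ = (g - ContinuousMap.const Y (g y₀)) * ψ + g y₀ • ψ := by
      ext x; simp [sub_mul]
    have h3 : elemOp μ ν (f x₀ • χ) (g * ψ) =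
        elemOp μ ν (f x₀ • χ) ((g - ContinuousMap.const Y (g y₀)) * ψ) +
          (f x₀ * g y₀) • elemOp μ ν χ ψ := by
      conv_lhs => rw [h2]
      rw [elemOp_add_right, elemOp_smul_right, elemOp_smul_left, elemOp_smul_left, mul_comm (f x₀),
        mul_smul]
    rw [← elemOp_mul, ← h3]
    conv_lhs => rw [h1]
    exact elemOp_add_left μ ν _ _ _
  · refine (norm_elemOp_le μ ν _ _).trans (mul_le_mul_of_nonneg_left ?_ (norm_nonneg _))
    exact (norm_mul_le _ _).trans (mul_le_of_le_one_right (norm_nonneg _) hψ)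
  · refine (norm_elemOp_le μ ν _ _).trans (mul_le_mul_of_nonneg_right ?_ (norm_nonneg _))
    rw [norm_smul]
    exact (mul_le_of_le_one_right (norm_nonneg _) hχ).trans (f.norm_coe_le_norm _)

omit [MeasurableSpace X] [BorelSpace X] in
theorem norm_sub_const_mul_le (f χ : C(X, ℂ)) (hχ : ‖χ‖ ≤ 1) (x₀ : X) {O : Set X} {δ : ℝ}
    (hδ : 0 ≤ δ) (hO : ∀ x ∈ O, ‖f x - f x₀‖ ≤ δ) (h0 : ∀ x, x ∉ O → χ x = 0) :
    ‖(f - ContinuousMap.const X (f x₀)) * χ‖ ≤ δ := by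
  refine (ContinuousMap.norm_le _ hδ).2 fun x => ?_
  rw [ContinuousMap.mul_apply, norm_mul]
  by_cases hx : x ∈ O
  · exact (mul_le_of_le_one_right (norm_nonneg _) ((χ.norm_coe_le_norm x).trans hχ)).trans
      (hO x hx)
  · rw [h0 x hx]; simpa using hδ

omit [MeasurableSpace X] [BorelSpace X] in
theorem norm_sub_const_mul_le_two (f χ : C(X, ℂ)) (hχ : ‖χ‖ ≤ 1) (x₀ : X) :
    ‖(f - ContinuousMap.const X (f x₀)) * χ‖ ≤ 2 * ‖f‖ :=
  norm_sub_const_mul_le f χ hχ x₀ (O := Set.univ) (by positivity)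
    (fun x _ => (norm_sub_le _ _).trans
      (by linarith [f.norm_coe_le_norm x, f.norm_coe_le_norm x₀])) (by simp)

/-- Cutting `F - F(p)` off to a small neighbourhood of `p` makes the multiplication operator small.
This is where the absolute convergence of `∑ ‖fₙ‖ ‖gₙ‖` enters: a finite part of the series is
small near `p` by continuity, the rest is small everywhere. -/
theorem exists_nhds_norm_mulBy_sub_mul_le (F : Varopoulos X Y) (x₀ : X) (y₀ : Y) {ε : ℝ}
    (hε : 0 < ε) : ∃ O ∈ 𝓝 x₀, ∃ W ∈ 𝓝 y₀, ∀ (χ : C(X, ℂ)) (ψ : C(Y, ℂ)), ‖χ‖ ≤ 1 → ‖ψ‖ ≤ 1 →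
      (∀ x, x ∉ O → χ x = 0) → (∀ y, y ∉ W → ψ y = 0) →
      ‖(mulBy μ ν F - F.1 (x₀, y₀) • 1) * elemOp μ ν χ ψ‖ ≤ ε := by
  obtain ⟨f, g, hrep⟩ := F.2
  have hb : Summable fun n => 4 * (‖f n‖ * ‖g n‖) := hrep.1.mul_left 4
  obtain ⟨N, hN⟩ : ∃ N, ∑' n, 4 * (‖f (n + N)‖ * ‖g (n + N)‖) < ε / 2 :=
    (((tendsto_sum_nat_add fun n => 4 * (‖f n‖ * ‖g n‖)).eventually
      (gt_mem_nhds (half_pos hε))).exists)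
  set η : ℝ := ε / (4 * (N + 1)) with hη
  have hη0 : 0 < η := by positivity
  refine ⟨{x | ∀ n ∈ Finset.range N, ‖f n x - f n x₀‖ < η / (‖g n‖ + 1)}, ?_,
    {y | ∀ n ∈ Finset.range N, ‖g n y - g n y₀‖ < η / (‖f n‖ + 1)}, ?_, ?_⟩
  · refine (Filter.eventually_all_finset _).2 fun n _ => ?_
    have : Tendsto (fun x => ‖f n x - f n x₀‖) (𝓝 x₀) (𝓝 ‖f n x₀ - f n x₀‖) :=
      Continuous.tendsto (by fun_prop) x₀
    refine this.eventually (gt_mem_nhds ?_)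
    rw [sub_self, norm_zero]; positivity
  · refine (Filter.eventually_all_finset _).2 fun n _ => ?_
    have : Tendsto (fun x => ‖g n x - g n y₀‖) (𝓝 y₀) (𝓝 ‖g n y₀ - g n y₀‖) :=
      Continuous.tendsto (by fun_prop) y₀
    refine this.eventually (gt_mem_nhds ?_)
    rw [sub_self, norm_zero]; positivity
  intro χ ψ hχ hψ hχ0 hψ0
  set t : ℕ → ℝ := fun n => ‖(f n - ContinuousMap.const X (f n x₀)) * χ‖ * ‖g n‖ +
        ‖f n‖ * ‖(g n - ContinuousMap.const Y (g n y₀)) * ψ‖ with ht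
  have ht4 : ∀ n, t n ≤ 4 * (‖f n‖ * ‖g n‖) := fun n => by
    have h1 := mul_le_mul_of_nonneg_right (norm_sub_const_mul_le_two (f n) χ hχ x₀)
      (norm_nonneg (g n))
    have h2 := mul_le_mul_of_nonneg_left (norm_sub_const_mul_le_two (g n) ψ hψ y₀)
      (norm_nonneg (f n))
    simp only [ht]
    linarith
  have ht0 : ∀ n, 0 ≤ t n := fun n => by positivity
  have hts : Summable t := Summable.of_nonneg_of_le ht0 ht4 hb
  have htη : ∀ n ∈ Finset.range N, t n ≤ 2 * η := fun n hn => by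
    have h1 := norm_sub_const_mul_le (f n) χ hχ x₀ (δ := η / (‖g n‖ + 1)) (by positivity)
      (fun x hx => (hx n hn).le) hχ0
    have h2 := norm_sub_const_mul_le (g n) ψ hψ y₀ (δ := η / (‖f n‖ + 1)) (by positivity)
      (fun x hx => (hx n hn).le) hψ0
    have h3 : ∀ a : ℝ, 0 ≤ a → η / (a + 1) * a ≤ η := fun a ha => by
      rw [div_mul_eq_mul_div, div_le_iff₀ (by positivity)]
      nlinarith
    have h4 := mul_le_mul_of_nonneg_right h1 (norm_nonneg (g n))
    have h5 := mul_le_mul_of_nonneg_left h2 (norm_nonneg (f n))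
    have h6 := h3 _ (norm_nonneg (g n))
    have h7 := h3 _ (norm_nonneg (f n))
    simp only [ht]
    linarith
  refine (norm_hasSum_sub_smul_one_mul_le (E := Lp ℂ 2 μ →L[ℂ] Lp ℂ 2 ν)
    (hasSum_mulBy μ ν F hrep) (hrep.2 x₀ y₀) hts fun n =>
      norm_elemOp_sub_mul_le μ ν (f n) χ (g n) ψ hχ hψ x₀ y₀).trans ?_
  rw [← hts.sum_add_tsum_nat_add N]
  have h1 : ∑ n ∈ Finset.range N, t n ≤ N * (2 * η) := by
    simpa using Finset.sum_le_sum htη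
  have h2 : ∑' n, t (n + N) ≤ ∑' n, 4 * (‖f (n + N)‖ * ‖g (n + N)‖) :=
    ((summable_nat_add_iff N).2 hts).tsum_le_tsum (fun n => ht4 _)
      ((summable_nat_add_iff N).2 hb)
  have h3 : N * (2 * η) ≤ ε / 2 := by
    have : η * (4 * (N + 1)) = ε := by rw [hη]; field_simp
    nlinarith
  linarith

/-- Near each point `p`, the operator `Δ_F` is a small perturbation of the scalar `F(p)`: on the
range of some `elemOp f g` with `f ⊗ g = 1` near `p` it acts as `F(p) + R` with `R` small. -/
theorem exists_local_form [T2Space X] [T2Space Y] (F : Varopoulos X Y) (x₀ : X) (y₀ : Y) {ε : ℝ}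
    (hε : 0 < ε) : ∃ (f : C(X, ℂ)) (g : C(Y, ℂ))
      (R : (Lp ℂ 2 μ →L[ℂ] Lp ℂ 2 ν) →L[ℂ] (Lp ℂ 2 μ →L[ℂ] Lp ℂ 2 ν)),
      (∀ᶠ x in 𝓝 x₀, f x = 1) ∧ (∀ᶠ y in 𝓝 y₀, g y = 1) ∧ ‖R‖ ≤ ε ∧
      ∀ n, mulBy μ ν F ^ n * elemOp μ ν f g = (F.1 (x₀, y₀) • 1 + R) ^ n * elemOp μ ν f g := by
  obtain ⟨O, hO, W, hW, h⟩ := exists_nhds_norm_mulBy_sub_mul_le μ ν F x₀ y₀ hε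
  obtain ⟨χ, f, hχ, hχ0, hχf, hf⟩ := exists_cutoff x₀ hO
  obtain ⟨ψ, g, hψ, hψ0, hψg, hg⟩ := exists_cutoff y₀ hW
  refine ⟨f, g, _, hf, hg, h χ ψ hχ hψ hχ0 hψ0, fun n => ?_⟩
  refine pow_mul_eq_of_mul_eq (E := Lp ℂ 2 μ →L[ℂ] Lp ℂ 2 ν) _ ?_ (commute_elemOp μ ν _ _ _ _)
    (commute_mulBy μ ν F fun _ _ => commute_elemOp μ ν _ _ _ _) n
  rw [← elemOp_mul, hχf, hψg]

/-- Off its null set, `F` is locally invertible: an elementary operator concentrated near such a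
point annihilates the whole spectral subspace, hence in particular the kernel of `Δ_F`. -/
theorem exists_elemOp_eq_zero [T2Space X] [T2Space Y] (F : Varopoulos X Y) (x₀ : X) (y₀ : Y)
    (hF : F.1 (x₀, y₀) ≠ 0) : ∃ (f : C(X, ℂ)) (g : C(Y, ℂ)),
      (∀ᶠ x in 𝓝 x₀, f x = 1) ∧ (∀ᶠ y in 𝓝 y₀, g y = 1) ∧
      ∀ T ∈ zeroSpectralSubspace (mulBy μ ν F), elemOp μ ν f g T = 0 := by
  obtain ⟨f, g, R, hf, hg, hR, h⟩ := exists_local_form μ ν F x₀ y₀ (half_pos (norm_pos_iff.2 hF))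
  exact ⟨f, g, hf, hg, fun T hT =>
    eq_zero_of_mem_zeroSpectralSubspace (E := Lp ℂ 2 μ →L[ℂ] Lp ℂ 2 ν) hF hR
      (commute_mulBy μ ν F fun _ _ => commute_elemOp μ ν _ _ _ _) h hT⟩

/-- Elementary tensors `f ⊗ g` suffice to bound the support of an operator. -/
theorem moduleSupp_subset_of_elemOp {T : Lp ℂ 2 μ →L[ℂ] Lp ℂ 2 ν} {F : Varopoulos X Y}
    (h : ∀ x₀ y₀, F.1 (x₀, y₀) ≠ 0 → ∃ (f : C(X, ℂ)) (g : C(Y, ℂ)),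
      f x₀ = 1 ∧ g y₀ = 1 ∧ elemOp μ ν f g T = 0) : moduleSupp T ⊆ nullSet F := by
  rintro ⟨x, y⟩ hp
  by_contra hF
  obtain ⟨f, g, hf, hg, hT⟩ := h x y hF
  have : (x, y) ∈ nullSet (tensor f g) :=
    Set.mem_iInter₂.1 hp (tensor f g) (by
    change mulBy μ ν (tensor f g) T = 0
    rw [mulBy_tensor, hT])
  have h2 : f x * g y = 0 := this
  rw [hf, hg] at h2
  norm_num at h2

theorem moduleSupp_subset_of_mem_zeroSpectralSubspace [T2Space X] [T2Space Y]
    (F : Varopoulos X Y) {T : Lp ℂ 2 μ →L[ℂ] Lp ℂ 2 ν}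
    (hT : T ∈ zeroSpectralSubspace (mulBy μ ν F)) : moduleSupp T ⊆ nullSet F := by
  refine moduleSupp_subset_of_elemOp μ ν fun x₀ y₀ h => ?_
  obtain ⟨f, g, hf, hg, hE⟩ := exists_elemOp_eq_zero μ ν F x₀ y₀ h
  exact ⟨f, g, hf.self_of_nhds, hg.self_of_nhds, hE T hT⟩

theorem moduleSupp_subset_of_mem_refHull [T2Space X] [T2Space Y]
    (F : Varopoulos X Y) {A : Lp ℂ 2 μ →L[ℂ] Lp ℂ 2 ν}
    (hA : A ∈ refHull (solutionSpace μ ν F)) : moduleSupp A ⊆ nullSet F := by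
  refine moduleSupp_subset_of_elemOp μ ν fun x₀ y₀ h => ?_
  obtain ⟨f, g, hf, hg, hE⟩ := exists_elemOp_eq_zero μ ν F x₀ y₀ h
  refine ⟨f, g, hf.self_of_nhds, hg.self_of_nhds, ContinuousLinearMap.ext fun u => ?_⟩
  have hcl : IsClosed {w : Lp ℂ 2 ν | mulOp ν g w = 0} :=
    isClosed_eq (mulOp ν g).continuous continuous_const
  refine hcl.closure_subset_iff.2 ?_ (hA (mulOp μ f u))
  rintro _ ⟨S, hS, rfl⟩
  exact congrArg (· u) (hE S (mem_zeroSpectralSubspace_of_apply_eq_zero _ hS))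

end LocalForm

/-! ### Compression to rectangles and localization -/

section Localization

section Restriction

variable {X : Type*} [MeasurableSpace X] (μ : Measure X)

/-- Multiplication on `L²` by a function of `L^∞`. -/
def linfMul (k : Lp ℂ ∞ μ) : Lp ℂ 2 μ →L[ℂ] Lp ℂ 2 μ :=
  (ContinuousLinearMap.mul ℂ ℂ).holderL μ ∞ 2 2 k

theorem linfMul_ae (k : Lp ℂ ∞ μ) (u : Lp ℂ 2 μ) : linfMul μ k u =ᵐ[μ] fun x => k x * u x :=
  (ContinuousLinearMap.mul ℂ ℂ).coeFn_holder k u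

variable [IsFiniteMeasure μ]

/-- The projection of `L²(X, μ)` onto the functions that vanish off `A`. -/
def restr {A : Set X} (hA : MeasurableSet A) : Lp ℂ 2 μ →L[ℂ] Lp ℂ 2 μ :=
  linfMul μ (indicatorConstLp ∞ hA (measure_ne_top μ A) 1)

theorem restr_ae {A : Set X} (hA : MeasurableSet A) (u : Lp ℂ 2 μ) :
    restr μ hA u =ᵐ[μ] A.indicator u := by
  filter_upwards [linfMul_ae μ (indicatorConstLp ∞ hA (measure_ne_top μ A) 1) u,
    indicatorConstLp_coeFn (p := ∞) (hs := hA) (hμs := measure_ne_top μ A) (c := (1 : ℂ))]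
    with x h1 h2
  rw [restr, h1, h2]
  by_cases hx : x ∈ A <;> simp [hx]

theorem restr_comp_restr {A B : Set X} (hA : MeasurableSet A) (hB : MeasurableSet B)
    (h : A ⊆ B) : (restr μ hA).comp (restr μ hB) = restr μ hA := by
  refine ContinuousLinearMap.ext fun u => Lp.ext ?_
  rw [ContinuousLinearMap.comp_apply]
  filter_upwards [restr_ae μ hA u, restr_ae μ hB u, restr_ae μ hA (restr μ hB u)] with x h1 h2 h3
  rw [h3, h1]
  by_cases hx : x ∈ A
  · simp [hx, h2, h hx]
  · simp [hx]

theorem restr_comp_restr' {A B : Set X} (hA : MeasurableSet A) (hB : MeasurableSet B)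
    (h : A ⊆ B) : (restr μ hB).comp (restr μ hA) = restr μ hA := by
  refine ContinuousLinearMap.ext fun u => Lp.ext ?_
  rw [ContinuousLinearMap.comp_apply]
  filter_upwards [restr_ae μ hA u, restr_ae μ hB (restr μ hA u)] with x h1 h3
  rw [h3]
  by_cases hx : x ∈ B
  · simp [hx]
  · have : x ∉ A := fun hxA => hx (h hxA)
    simp [hx, h1, this]

theorem restr_union {A B : Set X} (hA : MeasurableSet A) (hB : MeasurableSet B) :
    restr μ (hA.union hB) = restr μ hA + restr μ (hB.diff hA) := by
  refine ContinuousLinearMap.ext fun u => Lp.ext ?_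
  rw [_root_.add_apply]
  filter_upwards [restr_ae μ hA u, restr_ae μ (hB.diff hA) u, restr_ae μ (hA.union hB) u,
    Lp.coeFn_add (restr μ hA u) (restr μ (hB.diff hA) u)] with x h1 h2 h3 h4
  rw [h3, h4, Pi.add_apply, h1, h2]
  by_cases hx : x ∈ A <;> by_cases hx' : x ∈ B <;> simp [hx, hx']

theorem restr_empty : restr μ (MeasurableSet.empty (α := X)) = 0 := by
  refine ContinuousLinearMap.ext fun u => Lp.ext ?_
  filter_upwards [restr_ae μ MeasurableSet.empty u, Lp.coeFn_zero ℂ 2 μ] with x h1 h2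
  rw [h1, _root_.zero_apply, h2]
  simp

theorem restr_univ : restr μ (MeasurableSet.univ (α := X)) = .id ℂ _ := by
  refine ContinuousLinearMap.ext fun u => Lp.ext ?_
  filter_upwards [restr_ae μ MeasurableSet.univ u] with x h1
  rw [h1, Set.indicator_univ, ContinuousLinearMap.id_apply]

theorem restr_comp_mulOp [TopologicalSpace X] [CompactSpace X] [BorelSpace X] {A : Set X}
    (hA : MeasurableSet A) (f : C(X, ℂ)) :
    (restr μ hA).comp (mulOp μ f) = (mulOp μ f).comp (restr μ hA) := by
  refine ContinuousLinearMap.ext fun u => Lp.ext ?_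
  rw [ContinuousLinearMap.comp_apply, ContinuousLinearMap.comp_apply]
  filter_upwards [restr_ae μ hA u, mulOp_ae μ f u, restr_ae μ hA (mulOp μ f u),
    mulOp_ae μ f (restr μ hA u)] with x h1 h2 h3 h4
  rw [h3, h4, h1]
  by_cases hx : x ∈ A
  · simp [hx, h2]
  · simp [hx]

theorem mulOp_comp_restr_of_eq_one [TopologicalSpace X] [CompactSpace X] [BorelSpace X] {A : Set X}
    (hA : MeasurableSet A) {f : C(X, ℂ)} (hf : ∀ x ∈ A, f x = 1) :
    (mulOp μ f).comp (restr μ hA) = restr μ hA := by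
  refine ContinuousLinearMap.ext fun u => Lp.ext ?_
  rw [ContinuousLinearMap.comp_apply]
  filter_upwards [restr_ae μ hA u, mulOp_ae μ f (restr μ hA u)] with x h1 h4
  rw [h4, h1]
  by_cases hx : x ∈ A
  · simp [hf x hx]
  · simp [hx]

end Restriction

section Compression

variable {X Y : Type*} [MeasurableSpace X] [MeasurableSpace Y]
  (μ : Measure X) (ν : Measure Y) [IsFiniteMeasure μ] [IsFiniteMeasure ν]

/-- The compression `T ↦ P_B T P_A` of operators to the rectangle `A × B`. -/
def compr {A : Set X} {B : Set Y} (hA : MeasurableSet A) (hB : MeasurableSet B) :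
    (Lp ℂ 2 μ →L[ℂ] Lp ℂ 2 ν) →L[ℂ] (Lp ℂ 2 μ →L[ℂ] Lp ℂ 2 ν) :=
  (ContinuousLinearMap.compL ℂ (Lp ℂ 2 μ) (Lp ℂ 2 ν) (Lp ℂ 2 ν) (restr ν hB)).comp
    ((ContinuousLinearMap.compL ℂ (Lp ℂ 2 μ) (Lp ℂ 2 μ) (Lp ℂ 2 ν)).flip (restr μ hA))

variable {A A' : Set X} {B B' : Set Y} (hA : MeasurableSet A) (hA' : MeasurableSet A')
  (hB : MeasurableSet B) (hB' : MeasurableSet B')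

theorem compr_apply (T : Lp ℂ 2 μ →L[ℂ] Lp ℂ 2 ν) :
    compr μ ν hA hB T = (restr ν hB).comp (T.comp (restr μ hA)) := rfl

theorem compr_compr (hAA : A ⊆ A') (hBB : B ⊆ B') (T : Lp ℂ 2 μ →L[ℂ] Lp ℂ 2 ν) :
    compr μ ν hA hB (compr μ ν hA' hB' T) = compr μ ν hA hB T := by
  refine ContinuousLinearMap.ext fun u => ?_
  have h1 := DFunLike.congr_fun (restr_comp_restr' μ hA hA' hAA) u
  have h2 := DFunLike.congr_fun (restr_comp_restr ν hB hB' hBB)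
  simp only [ContinuousLinearMap.comp_apply] at h1 h2
  simp only [compr_apply, ContinuousLinearMap.comp_apply, h1, h2]

theorem compr_union_left (T : Lp ℂ 2 μ →L[ℂ] Lp ℂ 2 ν) :
    compr μ ν (hA.union hA') hB T = compr μ ν hA hB T + compr μ ν (hA'.diff hA) hB T := by
  refine ContinuousLinearMap.ext fun u => ?_
  have h := restr_union μ hA hA'
  simp only [compr_apply, h, ContinuousLinearMap.comp_apply, _root_.add_apply, map_add]

theorem compr_union_right (T : Lp ℂ 2 μ →L[ℂ] Lp ℂ 2 ν) :
    compr μ ν hA (hB.union hB') T = compr μ ν hA hB T + compr μ ν hA (hB'.diff hB) T := by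
  refine ContinuousLinearMap.ext fun u => ?_
  have h := restr_union ν hB hB'
  simp only [compr_apply, h, ContinuousLinearMap.comp_apply, _root_.add_apply]

variable [TopologicalSpace X] [CompactSpace X] [BorelSpace X]
  [TopologicalSpace Y] [CompactSpace Y] [BorelSpace Y]

theorem commute_elemOp_compr (f : C(X, ℂ)) (g : C(Y, ℂ)) :
    Commute (elemOp μ ν f g) (compr μ ν hA hB) := by
  refine ContinuousLinearMap.ext fun T => ?_
  rw [mul_apply_eq_comp, mul_apply_eq_comp, elemOp_apply, elemOp_apply, compr_apply, compr_apply]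
  refine ContinuousLinearMap.ext fun u => ?_
  have h1 := fun w => congrArg (fun S => S w) (restr_comp_mulOp μ hA f)
  have h2 := fun w => congrArg (fun S => S w) (restr_comp_mulOp ν hB g)
  simp only [ContinuousLinearMap.comp_apply] at h1 h2 ⊢
  rw [h1, h2]

theorem compr_elemOp_of_eq_one {f : C(X, ℂ)} {g : C(Y, ℂ)} (hf : ∀ x ∈ A, f x = 1)
    (hg : ∀ y ∈ B, g y = 1) (T : Lp ℂ 2 μ →L[ℂ] Lp ℂ 2 ν) :
    compr μ ν hA hB (elemOp μ ν f g T) = compr μ ν hA hB T := by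
  rw [compr_apply, compr_apply, elemOp_apply, ContinuousLinearMap.comp_assoc,
    ContinuousLinearMap.comp_assoc, mulOp_comp_restr_of_eq_one μ hA hf,
    ← ContinuousLinearMap.comp_assoc, restr_comp_mulOp, mulOp_comp_restr_of_eq_one ν hB hg]

end Compression

/-- Compactness of a rectangle: a property of open rectangles that is inherited by smaller
rectangles and by unions in either variable holds near `K × L` if it holds near each of its
points. -/
theorem exists_opens_of_isCompact {X Y : Type*} [TopologicalSpace X] [TopologicalSpace Y]
    {K : Set X} {L : Set Y} (hK : IsCompact K) (hL : IsCompact L)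
    {Q : TopologicalSpace.Opens X → TopologicalSpace.Opens Y → Prop}
    (hbotl : ∀ W, Q ⊥ W) (hbotr : ∀ O, Q O ⊥)
    (hmono : ∀ {O O' W W'}, O ≤ O' → W ≤ W' → Q O' W' → Q O W)
    (hsupl : ∀ {O O' W}, Q O W → Q O' W → Q (O ⊔ O') W)
    (hsupr : ∀ {O W W'}, Q O W → Q O W' → Q O (W ⊔ W'))
    (hloc : ∀ x ∈ K, ∀ y ∈ L, ∃ (O : TopologicalSpace.Opens X)
      (W : TopologicalSpace.Opens Y), x ∈ O ∧ y ∈ W ∧ Q O W) :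
    ∃ (O : TopologicalSpace.Opens X) (W : TopologicalSpace.Opens Y), K ⊆ O ∧ L ⊆ W ∧ Q O W := by
  refine hK.induction_on (p := fun A => ∃ (O : TopologicalSpace.Opens X)
    (W : TopologicalSpace.Opens Y), A ⊆ O ∧ L ⊆ W ∧ Q O W) ?_ ?_ ?_ fun x hx => ?_
  · exact ⟨⊥, ⊤, by simp, by simp, hbotl _⟩
  · rintro s t hst ⟨O, W, h1, h2, h3⟩
    exact ⟨O, W, hst.trans h1, h2, h3⟩
  · rintro s t ⟨O, W, h1, h2, h3⟩ ⟨O', W', h1', h2', h3'⟩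
    exact ⟨O ⊔ O', W ⊓ W', Set.union_subset_union h1 h1', Set.subset_inter h2 h2',
      hsupl (hmono le_rfl inf_le_left h3) (hmono le_rfl inf_le_right h3')⟩
  · have : ∃ (O : TopologicalSpace.Opens X) (W : TopologicalSpace.Opens Y),
        x ∈ O ∧ L ⊆ W ∧ Q O W := by
      refine hL.induction_on (p := fun B => ∃ (O : TopologicalSpace.Opens X)
        (W : TopologicalSpace.Opens Y), x ∈ O ∧ B ⊆ W ∧ Q O W) ?_ ?_ ?_ fun y hy => ?_
      · exact ⟨⊤, ⊥, trivial, by simp, hbotr _⟩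
      · rintro s t hst ⟨O, W, h1, h2, h3⟩
        exact ⟨O, W, h1, hst.trans h2, h3⟩
      · rintro s t ⟨O, W, h1, h2, h3⟩ ⟨O', W', h1', h2', h3'⟩
        exact ⟨O ⊓ O', W ⊔ W', ⟨h1, h1'⟩, Set.union_subset_union h2 h2',
          hsupr (hmono inf_le_left le_rfl h3) (hmono inf_le_right le_rfl h3')⟩
      · obtain ⟨O, W, h1, h2, h3⟩ := hloc x hx y hy
        exact ⟨W, mem_nhdsWithin_of_mem_nhds (W.isOpen.mem_nhds h2), O, W, h1, subset_rfl, h3⟩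
    obtain ⟨O, W, h1, h2, h3⟩ := this
    exact ⟨O, mem_nhdsWithin_of_mem_nhds (O.isOpen.mem_nhds h1), O, W, subset_rfl, h2, h3⟩

variable {X Y : Type*} [TopologicalSpace X] [CompactSpace X] [MeasurableSpace X] [BorelSpace X]
  [TopologicalSpace Y] [CompactSpace Y] [MeasurableSpace Y] [BorelSpace Y]
  (μ : Measure X) (ν : Measure Y) [IsFiniteMeasure μ] [IsFiniteMeasure ν]

/-- Localization: a property of operators that is stable under sums and compressions holds for the
compression of `T` to a neighbourhood of `K × L` if near each point of `K × L` it holds for some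
`elemOp f g T` with `f ⊗ g = 1` near the point. -/
theorem exists_compr_of_local {P : (Lp ℂ 2 μ →L[ℂ] Lp ℂ 2 ν) → Prop} (h0 : P 0)
    (hadd : ∀ S S', P S → P S' → P (S + S'))
    (hcompr : ∀ (A : Set X) (B : Set Y) (hA : MeasurableSet A) (hB : MeasurableSet B) (S),
      P S → P (compr μ ν hA hB S))
    (T : Lp ℂ 2 μ →L[ℂ] Lp ℂ 2 ν) {K : Set X} {L : Set Y} (hK : IsCompact K) (hL : IsCompact L)
    (hloc : ∀ x ∈ K, ∀ y ∈ L, ∃ (f : C(X, ℂ)) (g : C(Y, ℂ)), (∀ᶠ x' in 𝓝 x, f x' = 1) ∧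
      (∀ᶠ y' in 𝓝 y, g y' = 1) ∧ P (elemOp μ ν f g T)) :
    ∃ (O : TopologicalSpace.Opens X) (W : TopologicalSpace.Opens Y), K ⊆ O ∧ L ⊆ W ∧
      P (compr μ ν O.isOpen.measurableSet W.isOpen.measurableSet T) := by
  refine exists_opens_of_isCompact hK hL (Q := fun O W =>
    P (compr μ ν O.isOpen.measurableSet W.isOpen.measurableSet T)) ?_ ?_ ?_ ?_ ?_ ?_
  · intro W
    have h : restr μ (⊥ : TopologicalSpace.Opens X).isOpen.measurableSet = 0 := restr_empty μ
    rwa [compr_apply, h, ContinuousLinearMap.comp_zero, ContinuousLinearMap.comp_zero]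
  · intro W
    have h : restr ν (⊥ : TopologicalSpace.Opens Y).isOpen.measurableSet = 0 := restr_empty ν
    rwa [compr_apply, h, ContinuousLinearMap.zero_comp]
  · intro O O' W W' hO hW h
    rw [← compr_compr μ ν _ O'.isOpen.measurableSet _ W'.isOpen.measurableSet hO hW]
    exact hcompr _ _ _ _ _ h
  · intro O O' W h h'
    have e := compr_union_left μ ν O.isOpen.measurableSet O'.isOpen.measurableSet
      W.isOpen.measurableSet T
    refine e ▸ hadd _ _ h ?_
    rw [← compr_compr μ ν _ O'.isOpen.measurableSet _ W.isOpen.measurableSet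
      Set.sdiff_subset subset_rfl]
    exact hcompr _ _ _ _ _ h'
  · intro O W W' h h'
    have e := compr_union_right μ ν O.isOpen.measurableSet W.isOpen.measurableSet
      W'.isOpen.measurableSet T
    refine e ▸ hadd _ _ h ?_
    rw [← compr_compr μ ν _ O.isOpen.measurableSet _ W'.isOpen.measurableSet
      subset_rfl Set.sdiff_subset]
    exact hcompr _ _ _ _ _ h'
  · intro x hx y hy
    obtain ⟨f, g, hf, hg, h⟩ := hloc x hx y hy
    refine ⟨⟨interior {x | f x = 1}, isOpen_interior⟩, ⟨interior {y | g y = 1}, isOpen_interior⟩,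
      mem_interior_iff_mem_nhds.2 hf, mem_interior_iff_mem_nhds.2 hg, ?_⟩
    have e := compr_elemOp_of_eq_one μ ν (A := interior {x | f x = 1}) (B := interior {y | g y = 1})
      isOpen_interior.measurableSet isOpen_interior.measurableSet
      (fun x hx => interior_subset (s := {x | f x = 1}) hx)
      (fun y hy => interior_subset (s := {y | g y = 1}) hy) T
    exact e ▸ hcompr _ _ _ _ _ h

omit [IsFiniteMeasure μ] [IsFiniteMeasure ν] in
theorem exists_elemOp_eq_zero_of_notMem_moduleSupp [T2Space X] [T2Space Y]
    (T : Lp ℂ 2 μ →L[ℂ] Lp ℂ 2 ν) (x : X) (y : Y) (h : (x, y) ∉ moduleSupp T) :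
    ∃ (f : C(X, ℂ)) (g : C(Y, ℂ)), (∀ᶠ x' in 𝓝 x, f x' = 1) ∧
      (∀ᶠ y' in 𝓝 y, g y' = 1) ∧ elemOp μ ν f g T = 0 := by
  rw [moduleSupp, Set.mem_iInter₂] at h
  push Not at h
  obtain ⟨G, hG, hp⟩ := h
  obtain ⟨f, g, hf, hg, h⟩ := exists_elemOp_eq_zero μ ν G x y hp
  exact ⟨f, g, hf, hg, h T (mem_zeroSpectralSubspace_of_apply_eq_zero _ hG)⟩

/-- An operator vanishes on every compact rectangle disjoint from its support. -/
theorem compr_eq_zero_of_disjoint_moduleSupp [T2Space X] [T2Space Y]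
    (T : Lp ℂ 2 μ →L[ℂ] Lp ℂ 2 ν) {K : Set X} {L : Set Y} (hK : IsCompact K) (hL : IsCompact L)
    (h : ∀ x ∈ K, ∀ y ∈ L, (x, y) ∉ moduleSupp T) :
    compr μ ν hK.measurableSet hL.measurableSet T = 0 := by
  obtain ⟨O, W, hO, hW, h0⟩ := exists_compr_of_local μ ν (P := fun S => S = 0) rfl
    (fun S S' h h' => by rw [h, h', add_zero]) (fun A B hA hB S h => by rw [h, map_zero]) T hK hL
    fun x hx y hy => exists_elemOp_eq_zero_of_notMem_moduleSupp μ ν T x y (h x hx y hy)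
  rw [← compr_compr μ ν _ O.isOpen.measurableSet _ W.isOpen.measurableSet hO hW, h0, map_zero]

/-- If `T` is supported in `null(F)`, the powers of `Δ_F` decay on `T` faster than any geometric
sequence: near a point of `null(F)` this is the local form of `Δ_F`, and elsewhere `T` vanishes. -/
theorem norm_pow_le_of_moduleSupp_subset [T2Space X] [T2Space Y] (F : Varopoulos X Y)
    (T : Lp ℂ 2 μ →L[ℂ] Lp ℂ 2 ν) (h : moduleSupp T ⊆ nullSet F) {ε : ℝ} (hε : 0 < ε) :
    ∃ C, ∀ n, ‖(mulBy μ ν F ^ n) T‖ ≤ C * ε ^ n := by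
  have hcomm : ∀ (A : Set X) (B : Set Y) (hA : MeasurableSet A) (hB : MeasurableSet B),
      Commute (mulBy μ ν F) (compr μ ν hA hB) := fun A B hA hB =>
    commute_mulBy μ ν F fun f g => commute_elemOp_compr μ ν hA hB f g
  have hadd : ∀ S S' : Lp ℂ 2 μ →L[ℂ] Lp ℂ 2 ν, (∃ C, ∀ n, ‖(mulBy μ ν F ^ n) S‖ ≤ C * ε ^ n) →
      (∃ C, ∀ n, ‖(mulBy μ ν F ^ n) S'‖ ≤ C * ε ^ n) →
      ∃ C, ∀ n, ‖(mulBy μ ν F ^ n) (S + S')‖ ≤ C * ε ^ n := by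
    rintro S S' ⟨C, hC⟩ ⟨C', hC'⟩
    refine ⟨C + C', fun n => ?_⟩
    rw [map_add, add_mul]
    exact (norm_add_le _ _).trans (add_le_add (hC n) (hC' n))
  have hcompr : ∀ (A : Set X) (B : Set Y) (hA : MeasurableSet A) (hB : MeasurableSet B)
      (S : Lp ℂ 2 μ →L[ℂ] Lp ℂ 2 ν), (∃ C, ∀ n, ‖(mulBy μ ν F ^ n) S‖ ≤ C * ε ^ n) →
      ∃ C, ∀ n, ‖(mulBy μ ν F ^ n) (compr μ ν hA hB S)‖ ≤ C * ε ^ n := by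
    rintro A B hA hB S ⟨C, hC⟩
    refine ⟨‖compr μ ν hA hB‖ * C, fun n => ?_⟩
    rw [← mul_apply_eq_comp, ((hcomm A B hA hB).pow_left n).eq, mul_apply_eq_comp, mul_assoc]
    exact (ContinuousLinearMap.le_opNorm _ _).trans
      (mul_le_mul_of_nonneg_left (hC n) (norm_nonneg _))
  have hloc : ∀ x ∈ Set.univ, ∀ y ∈ Set.univ, ∃ (f : C(X, ℂ)) (g : C(Y, ℂ)),
      (∀ᶠ x' in 𝓝 x, f x' = 1) ∧ (∀ᶠ y' in 𝓝 y, g y' = 1) ∧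
      ∃ C, ∀ n, ‖(mulBy μ ν F ^ n) (elemOp μ ν f g T)‖ ≤ C * ε ^ n := by
    intro x _ y _
    by_cases hF : F.1 (x, y) = 0
    · obtain ⟨f, g, R, hf, hg, hR, hn⟩ := exists_local_form μ ν F x y hε
      refine ⟨f, g, hf, hg, ‖elemOp μ ν f g T‖, fun n => ?_⟩
      rw [← mul_apply_eq_comp, hn n, mul_apply_eq_comp, mul_comm]
      refine (norm_smul_one_add_pow_le (E := Lp ℂ 2 μ →L[ℂ] Lp ℂ 2 ν) _ R n _).trans ?_
      rw [hF, norm_zero, zero_add]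
      gcongr
    · obtain ⟨f, g, hf, hg, h0⟩ := exists_elemOp_eq_zero_of_notMem_moduleSupp μ ν T x y
        fun hxy => hF (h hxy)
      refine ⟨f, g, hf, hg, 0, fun n => ?_⟩
      rw [h0, map_zero, norm_zero, zero_mul]
  obtain ⟨O, W, hO, hW, C, hC⟩ := exists_compr_of_local μ ν ⟨0, fun n => by simp⟩ hadd hcompr T
    isCompact_univ isCompact_univ hloc
  obtain rfl : O = ⊤ := top_le_iff.1 hO
  obtain rfl : W = ⊤ := top_le_iff.1 hW
  have h1 : restr μ (⊤ : TopologicalSpace.Opens X).isOpen.measurableSet = .id ℂ _ := restr_univ μ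
  have h2 : restr ν (⊤ : TopologicalSpace.Opens Y).isOpen.measurableSet = .id ℂ _ := restr_univ ν
  refine ⟨C, fun n => ?_⟩
  have h3 := hC n
  rwa [compr_apply, h1, h2, ContinuousLinearMap.comp_id, ContinuousLinearMap.id_comp] at h3

theorem mem_zeroSpectralSubspace_of_norm_pow_le {E : Type*} [NormedAddCommGroup E]
    [NormedSpace ℂ E] {D : E →L[ℂ] E} {z : E}
    (h : ∀ ε : ℝ, 0 < ε → ∃ C, ∀ n, ‖(D ^ n) z‖ ≤ C * ε ^ n) : z ∈ zeroSpectralSubspace D := by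
  refine tendsto_order.2 ⟨fun a ha => Eventually.of_forall fun n =>
    ha.trans_le (Real.rpow_nonneg (norm_nonneg _) _), fun a ha => ?_⟩
  obtain ⟨C, hC⟩ := h (a / 4) (by positivity)
  filter_upwards [(tendsto_pow_atTop_atTop_of_one_lt (one_lt_two (α := ℝ))).eventually_ge_atTop C,
    eventually_ge_atTop 1] with n hn hn1
  have hn0 : n ≠ 0 := by omega
  have h1 : ‖(D ^ n) z‖ ≤ (a / 2) ^ n := by
    refine (hC n).trans ((mul_le_mul_of_nonneg_right hn (by positivity)).trans_eq ?_)
    rw [← mul_pow]; congr 1; ring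
  calc ‖(D ^ n) z‖ ^ (1 / (n : ℝ)) ≤ ((a / 2) ^ n) ^ (1 / (n : ℝ)) := by gcongr
    _ = a / 2 := by rw [one_div, Real.pow_rpow_inv_natCast (by positivity) hn0]
    _ < a := by linarith

/-- The spectral subspace consists of the operators supported in the null set of `F`. -/
theorem mem_zeroSpectralSubspace_iff [T2Space X] [T2Space Y] (F : Varopoulos X Y)
    (T : Lp ℂ 2 μ →L[ℂ] Lp ℂ 2 ν) :
    T ∈ zeroSpectralSubspace (mulBy μ ν F) ↔ moduleSupp T ⊆ nullSet F :=
  ⟨moduleSupp_subset_of_mem_zeroSpectralSubspace μ ν F, fun h =>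
    mem_zeroSpectralSubspace_of_norm_pow_le (E := Lp ℂ 2 μ →L[ℂ] Lp ℂ 2 ν)
      fun _ hε => norm_pow_le_of_moduleSupp_subset μ ν F T h hε⟩

end Localization

/-! ### Measures with dominated images -/

theorem integrable_continuousMap {X : Type*} [TopologicalSpace X] [CompactSpace X]
    [MeasurableSpace X] [BorelSpace X] (μ : Measure X) [IsFiniteMeasure μ] (f : C(X, ℝ)) :
    Integrable f μ :=
  f.continuous.integrable_of_hasCompactSupport (HasCompactSupport.of_compactSpace _)

/-- A finite measure is dominated by another one on compact sets if it is on non-negative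
continuous functions. -/
theorem measure_le_of_forall_integral_le {X : Type*} [TopologicalSpace X] [CompactSpace X]
    [T2Space X] [MeasurableSpace X] [BorelSpace X] {ρ μ : Measure X} [IsFiniteMeasure ρ]
    [IsFiniteMeasure μ] [μ.OuterRegular]
    (h : ∀ f : C(X, ℝ), 0 ≤ f → ∫ x, f x ∂ρ ≤ ∫ x, f x ∂μ) {K : Set X} (hK : IsCompact K) :
    ρ K ≤ μ K := by
  refine ENNReal.le_of_forall_pos_le_add fun ε hε _ => ?_
  obtain ⟨V, hKV, hV, hμV⟩ : ∃ V ⊇ K, IsOpen V ∧ μ V ≤ μ K + ε :=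
    Set.exists_isOpen_le_add K μ (ENNReal.coe_ne_zero.2 hε.ne')
  obtain ⟨f, hf1, hf0, hf⟩ := exists_continuous_zero_one_of_isClosed hV.isClosed_compl
    hK.isClosed (Set.disjoint_compl_left_iff_subset.2 hKV)
  have h1 : ρ.real K ≤ ∫ x, f x ∂ρ := by
    rw [← integral_indicator_one hK.measurableSet]
    refine integral_mono ((integrable_const 1).indicator hK.measurableSet)
      (integrable_continuousMap ρ f)
      fun x => ?_
    by_cases hx : x ∈ K
    · simp [hx, hf0 hx]
    · simpa [hx] using (hf x).1
  have h2 : ∫ x, f x ∂μ ≤ μ.real V := by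
    rw [← integral_indicator_one hV.measurableSet]
    refine integral_mono (integrable_continuousMap μ f)
      ((integrable_const 1).indicator hV.measurableSet)
      fun x => ?_
    by_cases hx : x ∈ V
    · simpa [hx] using (hf x).2
    · simp [hx, hf1 hx]
  have h3 : ρ.real K ≤ μ.real V := h1.trans ((h f fun x => (hf x).1).trans h2)
  exact ((ENNReal.toReal_le_toReal (measure_ne_top _ _) (measure_ne_top _ _)).1 h3).trans hμV

theorem le_of_forall_integral_le {X : Type*} [TopologicalSpace X] [CompactSpace X]
    [T2Space X] [MeasurableSpace X] [BorelSpace X] {ρ μ : Measure X} [IsFiniteMeasure ρ]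
    [IsFiniteMeasure μ] [μ.OuterRegular] [ρ.InnerRegular]
    (h : ∀ f : C(X, ℝ), 0 ≤ f → ∫ x, f x ∂ρ ≤ ∫ x, f x ∂μ) : ρ ≤ μ := by
  refine Measure.le_iff.2 fun E hE => ?_
  rw [hE.measure_eq_iSup_isCompact]
  exact iSup₂_le fun K hKE => iSup_le fun hK =>
    (measure_le_of_forall_integral_le h hK).trans (measure_mono hKE)

section Cover

variable {X Y Z : Type*} [TopologicalSpace X] [MeasurableSpace X]
  [TopologicalSpace Y] [MeasurableSpace Y]
  [TopologicalSpace Z] (μ : Measure X) (ν : Measure Y)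
  (p : C(Z, X)) (q : C(Z, Y))

/-- The costs `∫ a dμ + ∫ b dν` of the pairs `(a, b)` of non-negative continuous functions with
`h ≤ a ∘ p + b ∘ q`. -/
def coverCosts (h : Z → ℝ) : Set ℝ :=
  {c | ∃ (a : C(X, ℝ)) (b : C(Y, ℝ)), 0 ≤ a ∧ 0 ≤ b ∧ (∀ z, h z ≤ a (p z) + b (q z)) ∧
    c = ∫ x, a x ∂μ + ∫ y, b y ∂ν}

/-- The least cost of covering `h` by continuous functions of one variable each. -/
def coverCost (h : Z → ℝ) : ℝ := sInf (coverCosts μ ν p q h)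

theorem coverCosts_nonneg {h : Z → ℝ} {c : ℝ} (hc : c ∈ coverCosts μ ν p q h) : 0 ≤ c := by
  obtain ⟨a, b, ha, hb, -, rfl⟩ := hc
  exact add_nonneg (integral_nonneg fun x => ha x) (integral_nonneg fun y => hb y)

theorem bddBelow_coverCosts (h : Z → ℝ) : BddBelow (coverCosts μ ν p q h) :=
  ⟨0, fun _ hc => coverCosts_nonneg μ ν p q hc⟩

theorem coverCosts_nonempty [CompactSpace Z] (h : C(Z, ℝ)) :
    (coverCosts μ ν p q h).Nonempty :=
  ⟨_, ContinuousMap.const X ‖h‖, 0, fun _ => norm_nonneg h, le_rfl, fun z => by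
    simpa using (le_abs_self _).trans (h.norm_coe_le_norm z), rfl⟩

theorem coverCost_le {h : Z → ℝ} {a : C(X, ℝ)} {b : C(Y, ℝ)} (ha : 0 ≤ a) (hb : 0 ≤ b)
    (hab : ∀ z, h z ≤ a (p z) + b (q z)) : coverCost μ ν p q h ≤ ∫ x, a x ∂μ + ∫ y, b y ∂ν :=
  csInf_le (bddBelow_coverCosts μ ν p q h) ⟨a, b, ha, hb, hab, rfl⟩

theorem coverCost_nonneg (h : Z → ℝ) : 0 ≤ coverCost μ ν p q h :=
  Real.sInf_nonneg fun _ hc => coverCosts_nonneg μ ν p q hc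

open scoped Pointwise in
theorem coverCost_smul {t : ℝ} (ht : 0 < t) (h : Z → ℝ) :
    coverCost μ ν p q (t • h) = t * coverCost μ ν p q h := by
  have key : ∀ {s : ℝ}, 0 < s → ∀ (h : Z → ℝ) (c : ℝ), c ∈ coverCosts μ ν p q h →
      s * c ∈ coverCosts μ ν p q (s • h) := by
    rintro s hs h _ ⟨a, b, ha, hb, hab, rfl⟩
    refine ⟨s • a, s • b, smul_nonneg hs.le ha, smul_nonneg hs.le hb, fun z => ?_, ?_⟩
    · simpa [mul_add] using mul_le_mul_of_nonneg_left (hab z) hs.le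
    · simp [integral_const_mul, mul_add]
  have e : coverCosts μ ν p q (t • h) = t • coverCosts μ ν p q h := by
    ext c
    rw [Set.mem_smul_set]
    refine ⟨fun hc => ⟨t⁻¹ * c, ?_, by rw [smul_eq_mul, mul_inv_cancel_left₀ ht.ne']⟩, ?_⟩
    · simpa [smul_smul, ht.ne'] using key (inv_pos.2 ht) _ c hc
    · rintro ⟨c, hc, rfl⟩
      exact key ht h c hc
  rw [coverCost, e, Real.sInf_smul_of_nonneg ht.le, smul_eq_mul, coverCost]

open scoped Pointwise in
theorem coverCost_add_le [CompactSpace X] [CompactSpace Y] [BorelSpace X] [BorelSpace Y]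
    [IsFiniteMeasure μ] [IsFiniteMeasure ν] [CompactSpace Z] (h h' : C(Z, ℝ)) :
    coverCost μ ν p q (h + h') ≤ coverCost μ ν p q h + coverCost μ ν p q h' := by
  rw [coverCost, coverCost, coverCost, ← csInf_add (coverCosts_nonempty μ ν p q h)
    (bddBelow_coverCosts μ ν p q h) (coverCosts_nonempty μ ν p q h')
    (bddBelow_coverCosts μ ν p q h')]
  refine csInf_le_csInf (bddBelow_coverCosts μ ν p q _)
    ((coverCosts_nonempty μ ν p q h).add (coverCosts_nonempty μ ν p q h')) ?_
  rintro _ ⟨_, ⟨a, b, ha, hb, hab, rfl⟩, _, ⟨a', b', ha', hb', hab', rfl⟩, rfl⟩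
  refine ⟨a + a', b + b', add_nonneg ha ha', add_nonneg hb hb', fun z => ?_, ?_⟩
  · have := add_le_add (hab z) (hab' z)
    simp only [Pi.add_apply, ContinuousMap.add_apply] at this ⊢
    linarith
  · simp only [ContinuousMap.add_apply]
    rw [integral_add (integrable_continuousMap μ a) (integrable_continuousMap μ a'),
      integral_add (integrable_continuousMap ν b) (integrable_continuousMap ν b')]
    ring

open scoped CompactlySupported in
/-- Duality: if the constant `1` on `Z` cannot be covered at arbitrarily small cost, then `Z`
carries a non-zero measure whose images in `X` and `Y` are dominated by `μ` and `ν`. The measure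
represents a Hahn–Banach functional dominated by `coverCost`. -/
theorem exists_measure_of_coverCost [CompactSpace X] [T2Space X] [BorelSpace X] [CompactSpace Y]
    [T2Space Y] [BorelSpace Y] [IsFiniteMeasure μ] [μ.Regular] [IsFiniteMeasure ν] [ν.Regular]
    [CompactSpace Z] [T2Space Z] [MeasurableSpace Z] [BorelSpace Z]
    (hcost : 0 < coverCost μ ν p q fun _ => 1) :
    ∃ σ : Measure Z, IsFiniteMeasure σ ∧ σ ≠ 0 ∧ σ.map p ≤ μ ∧ σ.map q ≤ ν := by
  set one : C_c(Z, ℝ) := ⟨1, HasCompactSupport.of_compactSpace 1⟩ with hone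
  have hone1 : (one : Z → ℝ) = fun _ => 1 := rfl
  have hcost0 : ∀ h : Z → ℝ, (∀ z, h z ≤ 0) → coverCost μ ν p q h ≤ 0 := fun h hh => by
    simpa using coverCost_le μ ν p q (h := h) (a := 0) (b := 0) le_rfl le_rfl
      fun z => by simpa using hh z
  have hne : one ≠ 0 := fun h => by
    have h1 : (fun _ : Z => (1 : ℝ)) = 0 := by rw [← hone1, h]; rfl
    exact absurd (hcost0 _ fun z => (congrFun h1 z).le) (not_le.2 hcost)
  obtain ⟨Λ, hΛ1, hΛ⟩ := exists_extension_of_le_sublinear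
    (LinearPMap.mkSpanSingleton one (coverCost μ ν p q one) hne)
    (fun h => coverCost μ ν p q h) (fun t ht h => coverCost_smul μ ν p q ht h)
    (fun h h' => coverCost_add_le μ ν p q h.toContinuousMap h'.toContinuousMap) (by
      rintro ⟨x, hx⟩
      obtain ⟨t, rfl⟩ := Submodule.mem_span_singleton.1 hx
      refine (LinearPMap.mkSpanSingleton'_apply one _ _ t hx).trans_le ?_
      change t * _ ≤ coverCost μ ν p q (t • one : C_c(Z, ℝ))
      rcases lt_or_ge 0 t with ht | ht
      · exact (coverCost_smul μ ν p q ht one).ge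
      · exact (mul_nonpos_of_nonpos_of_nonneg ht (coverCost_nonneg μ ν p q _)).trans
          (coverCost_nonneg μ ν p q _))
  have hpos : ∀ h : C_c(Z, ℝ), 0 ≤ h → 0 ≤ Λ h := fun h hh => by
    have h1 := (hΛ (-h)).trans (hcost0 _ fun z => neg_nonpos.2 (hh z))
    rw [map_neg] at h1
    linarith
  have hΛone : Λ one = coverCost μ ν p q fun _ => 1 := by
    have h1 := hΛ1 ⟨(1 : ℝ) • one, Submodule.mem_span_singleton.2 ⟨1, rfl⟩⟩
    have h2 : Λ ((1 : ℝ) • one) = (1 : ℝ) • coverCost μ ν p q one :=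
      h1.trans (LinearPMap.mkSpanSingleton'_apply one _ _ 1 _)
    rwa [one_smul, one_smul] at h2
  set P : C_c(Z, ℝ) →ₚ[ℝ] ℝ := PositiveLinearMap.mk₀ Λ hpos with hP
  have hPΛ : ∀ h, P h = Λ h := fun h => rfl
  have hint := RealRMK.integral_rieszMeasure P
  refine ⟨RealRMK.rieszMeasure P, inferInstance, fun h0 => ?_, ?_, ?_⟩
  · have h1 := hint one
    rw [h0, integral_zero_measure, hPΛ, hΛone] at h1
    exact hcost.ne h1
  · have : ((RealRMK.rieszMeasure P).map p).InnerRegular :=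
      Measure.InnerRegular.map_of_continuous p.continuous
    have : IsFiniteMeasure ((RealRMK.rieszMeasure P).map p) := inferInstance
    refine le_of_forall_integral_le fun f hf => ?_
    rw [integral_map p.continuous.aemeasurable f.continuous.aestronglyMeasurable]
    refine (hint ⟨f.comp p, HasCompactSupport.of_compactSpace _⟩).le.trans ((hΛ _).trans ?_)
    simpa using coverCost_le μ ν p q (h := f.comp p) (a := f) (b := 0) hf le_rfl
      fun z => by simp
  · have : ((RealRMK.rieszMeasure P).map q).InnerRegular :=
      Measure.InnerRegular.map_of_continuous q.continuous
    have : IsFiniteMeasure ((RealRMK.rieszMeasure P).map q) := inferInstance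
    refine le_of_forall_integral_le fun f hf => ?_
    rw [integral_map q.continuous.aemeasurable f.continuous.aestronglyMeasurable]
    refine (hint ⟨f.comp q, HasCompactSupport.of_compactSpace _⟩).le.trans ((hΛ _).trans ?_)
    simpa using coverCost_le μ ν p q (h := f.comp q) (a := 0) (b := f) le_rfl hf
      fun z => by simp

end Cover

/-! ### Pseudo-integral operators -/

section PseudoIntegral

section Pullback

variable {X Z : Type*} [TopologicalSpace X] [MeasurableSpace X] [BorelSpace X]
  [TopologicalSpace Z] [MeasurableSpace Z] [BorelSpace Z]
  {μ : Measure X} {σ : Measure Z} (p : C(Z, X)) (hp : σ.map p ≤ μ)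

include hp in
theorem ae_comp_of_ae {P : X → Prop} (h : ∀ᵐ x ∂μ, P x) : ∀ᵐ z ∂σ, P (p z) :=
  ae_of_ae_map p.continuous.aemeasurable (ae_mono hp h)

include hp in
theorem memLp_comp (u : Lp ℂ 2 μ) : MemLp (u ∘ p) 2 σ :=
  ((Lp.memLp u).mono_measure hp).comp_of_map p.continuous.aemeasurable

/-- The composition operator `u ↦ u ∘ p` from `L²(X, μ)` to `L²(Z, σ)`, where the image of `σ`
under `p` is dominated by `μ`. -/
def pullback : Lp ℂ 2 μ →L[ℂ] Lp ℂ 2 σ :=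
  LinearMap.mkContinuous
    { toFun := fun u => (memLp_comp p hp u).toLp (u ∘ p)
      map_add' := fun u v => by
        rw [← MemLp.toLp_add]
        exact MemLp.toLp_congr _ _ (ae_comp_of_ae p hp (Lp.coeFn_add u v))
      map_smul' := fun c u => by
        rw [RingHom.id_apply, ← MemLp.toLp_const_smul]
        exact MemLp.toLp_congr _ _ (ae_comp_of_ae p hp (Lp.coeFn_smul c u)) }
    1 fun u => by
      rw [one_mul]
      simp only [LinearMap.coe_mk, AddHom.coe_mk]
      rw [Lp.norm_toLp, Lp.norm_def, ← eLpNorm_map_measure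
        ((Lp.aestronglyMeasurable u).mono_measure hp) p.continuous.aemeasurable]
      exact ENNReal.toReal_mono (Lp.eLpNorm_ne_top u) (eLpNorm_mono_measure _ hp)

theorem pullback_ae (u : Lp ℂ 2 μ) : pullback p hp u =ᵐ[σ] u ∘ p :=
  (memLp_comp p hp u).coeFn_toLp

theorem pullback_mulOp [CompactSpace X] [CompactSpace Z] (f : C(X, ℂ)) (u : Lp ℂ 2 μ) :
    pullback p hp (mulOp μ f u) = mulOp σ (f.comp p) (pullback p hp u) := by
  refine Lp.ext ?_
  filter_upwards [pullback_ae p hp (mulOp μ f u), ae_comp_of_ae p hp (mulOp_ae μ f u),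
    mulOp_ae σ (f.comp p) (pullback p hp u), pullback_ae p hp u] with z h1 h2 h3 h4
  rw [h1, h3, h4, Function.comp_apply, h2]
  rfl

end Pullback

section PairOp

theorem inner_mulOp_star {X : Type*} [TopologicalSpace X] [CompactSpace X] [MeasurableSpace X]
    [BorelSpace X] (μ : Measure X) (f : C(X, ℂ)) (u v : Lp ℂ 2 μ) :
    inner ℂ v (mulOp μ f u) = inner ℂ (mulOp μ (star f) v) u := by
  rw [L2.inner_def, L2.inner_def]
  refine integral_congr_ae ?_
  filter_upwards [mulOp_ae μ f u, mulOp_ae μ (star f) v] with x h1 h2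
  simp only [h1, h2, RCLike.inner_apply, ContinuousMap.star_apply, map_mul, starRingEnd_apply,
    star_star]
  ring

theorem linfMul_mulOp {Z : Type*} [TopologicalSpace Z] [CompactSpace Z] [MeasurableSpace Z]
    [BorelSpace Z] (σ : Measure Z) (k : Lp ℂ ∞ σ) (f : C(Z, ℂ)) (u : Lp ℂ 2 σ) :
    linfMul σ k (mulOp σ f u) = mulOp σ f (linfMul σ k u) := by
  refine Lp.ext ?_
  filter_upwards [linfMul_ae σ k (mulOp σ f u), mulOp_ae σ f u, mulOp_ae σ f (linfMul σ k u),
    linfMul_ae σ k u] with z h1 h2 h3 h4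
  rw [h1, h2, h3, h4]
  ring

/-- The multiplication operator as a bounded linear function of the symbol. -/
def mulOpL {Z : Type*} [TopologicalSpace Z] [CompactSpace Z] [MeasurableSpace Z]
    [BorelSpace Z] (σ : Measure Z) : C(Z, ℂ) →L[ℂ] (Lp ℂ 2 σ →L[ℂ] Lp ℂ 2 σ) :=
  LinearMap.mkContinuous { toFun := mulOp σ, map_add' := mulOp_add σ, map_smul' := mulOp_smul σ } 1
    fun f => by simpa using norm_mulOp_le σ f

variable {X Y Z : Type*} [TopologicalSpace X] [CompactSpace X] [MeasurableSpace X] [BorelSpace X]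
  [TopologicalSpace Y] [CompactSpace Y] [MeasurableSpace Y] [BorelSpace Y]
  [TopologicalSpace Z] [CompactSpace Z] [MeasurableSpace Z] [BorelSpace Z]
  {μ : Measure X} {ν : Measure Y} {σ : Measure Z}
  (p : C(Z, X)) (hp : σ.map p ≤ μ) (q : C(Z, Y)) (hq : σ.map q ≤ ν)

/-- The pseudo-integral operator `⟨S u, v⟩ = ∫ k(z) u(p z) conj(v(q z)) dσ(z)` given by a
measure `σ` with dominated images and a bounded density `k`. -/
def pairOp (k : Lp ℂ ∞ σ) : Lp ℂ 2 μ →L[ℂ] Lp ℂ 2 ν :=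
  (ContinuousLinearMap.adjoint (pullback q hq)).comp ((linfMul σ k).comp (pullback p hp))

omit [CompactSpace X] [CompactSpace Y] [CompactSpace Z] in
theorem inner_pairOp (k : Lp ℂ ∞ σ) (u : Lp ℂ 2 μ) (v : Lp ℂ 2 ν) :
    inner ℂ v (pairOp p hp q hq k u) =
      inner ℂ (pullback q hq v) (linfMul σ k (pullback p hp u)) := by
  rw [pairOp, ContinuousLinearMap.comp_apply, ContinuousLinearMap.adjoint_inner_right]
  rfl

theorem inner_elemOp_pairOp (k : Lp ℂ ∞ σ) (f : C(X, ℂ)) (g : C(Y, ℂ)) (u : Lp ℂ 2 μ)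
    (v : Lp ℂ 2 ν) :
    inner ℂ v (elemOp μ ν f g (pairOp p hp q hq k) u) =
      inner ℂ (pullback q hq v)
        (mulOp σ (g.comp q * f.comp p) (linfMul σ k (pullback p hp u))) := by
  have e : star (g.comp q) = (star g).comp q := rfl
  rw [elemOp_apply, ContinuousLinearMap.comp_apply, ContinuousLinearMap.comp_apply,
    inner_mulOp_star, inner_pairOp, pullback_mulOp, pullback_mulOp, linfMul_mulOp, mulOp_mul,
    ContinuousLinearMap.comp_apply, inner_mulOp_star σ (g.comp q), e]

/-- A pseudo-integral operator carried by the null set of `F` is annihilated by `F`. -/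
theorem mulBy_pairOp_eq_zero (F : Varopoulos X Y) (hF : ∀ z, F.1 (p z, q z) = 0)
    (k : Lp ℂ ∞ σ) : mulBy μ ν F (pairOp p hp q hq k) = 0 := by
  obtain ⟨f, g, hrep⟩ := F.2
  have hsum : HasSum (fun n => (g n).comp q * (f n).comp p) (0 : C(Z, ℂ)) := by
    have hs : Summable (fun n => (g n).comp q * (f n).comp p) := by
      refine Summable.of_norm_bounded hrep.1 fun n => ?_
      rw [mul_comm]
      refine (norm_mul_le _ _).trans (mul_le_mul ?_ ?_ (norm_nonneg _) (norm_nonneg _))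
      · exact (ContinuousMap.norm_le _ (norm_nonneg _)).2 fun z => (f n).norm_coe_le_norm _
      · exact (ContinuousMap.norm_le _ (norm_nonneg _)).2 fun z => (g n).norm_coe_le_norm _
    convert hs.hasSum
    ext z
    have h1 : HasSum (fun n => f n (p z) * g n (q z)) ((∑' n, (g n).comp q * (f n).comp p) z) := by
      have h2 := (ContinuousMap.hasSum_apply hs.hasSum z)
      simpa [mul_comm] using h2
    rw [ContinuousMap.zero_apply, ← hF z]
    exact (hrep.2 (p z) (q z)).unique h1
  refine ContinuousLinearMap.ext fun u => ext_inner_left ℂ fun v => ?_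
  rw [_root_.zero_apply, inner_zero_right]
  have h1 : HasSum (fun n => inner ℂ v (elemOp μ ν (f n) (g n) (pairOp p hp q hq k) u))
      (inner ℂ v (mulBy μ ν F (pairOp p hp q hq k) u)) :=
    (((hasSum_mulBy μ ν F hrep).mapL (ContinuousLinearMap.apply ℂ _ (pairOp p hp q hq k))).mapL
      (ContinuousLinearMap.apply ℂ _ u)).mapL (innerSL ℂ v)
  have h2 : HasSum (fun n => inner ℂ (pullback q hq v)
        (mulOp σ ((g n).comp q * (f n).comp p) (linfMul σ k (pullback p hp u))))
      (inner ℂ (pullback q hq v) (mulOpL σ 0 (linfMul σ k (pullback p hp u)))) :=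
    ((hsum.mapL (mulOpL σ)).mapL (ContinuousLinearMap.apply ℂ _ _)).mapL
      (innerSL ℂ (pullback q hq v))
  simp only [inner_elemOp_pairOp] at h1
  rw [map_zero, _root_.zero_apply, inner_zero_right] at h2
  exact h1.unique h2

end PairOp

end PseudoIntegral

/-! ### The reflexive hull of the solution space -/

section ReflexiveHull

section Restriction

variable {X : Type*} [MeasurableSpace X] (μ : Measure X) [IsFiniteMeasure μ]

theorem inner_restr {A : Set X} (hA : MeasurableSet A) (u v : Lp ℂ 2 μ) :
    inner ℂ v (restr μ hA u) = inner ℂ (restr μ hA v) u := by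
  rw [L2.inner_def, L2.inner_def]
  refine integral_congr_ae ?_
  filter_upwards [restr_ae μ hA u, restr_ae μ hA v] with x h1 h2
  rw [h1, h2]
  by_cases hx : x ∈ A <;> simp [hx]

omit [IsFiniteMeasure μ] in
theorem measurableSet_ne_zero (u : Lp ℂ 2 μ) : MeasurableSet {x | u x ≠ 0} :=
  (Lp.stronglyMeasurable u).measurable (measurableSet_singleton 0).compl

/-- Absolute continuity: a set that carries the support of `u` up to small measure carries `u` up to
small norm. -/
theorem exists_norm_sub_restr_le (u : Lp ℂ 2 μ) {ε : ℝ} (hε : 0 < ε) :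
    ∃ δ > 0, ∀ (A : Set X) (hA : MeasurableSet A),
      μ ({x | u x ≠ 0} \ A) ≤ ENNReal.ofReal δ → ‖u - restr μ hA u‖ ≤ ε := by
  obtain ⟨δ, hδ, h⟩ := (Lp.memLp u).eLpNorm_indicator_le one_le_two ENNReal.ofNat_ne_top hε
  refine ⟨δ, hδ, fun A hA hμ => ?_⟩
  have h1 := h _ ((measurableSet_ne_zero μ u).diff hA) hμ
  rw [Lp.norm_def]
  refine ENNReal.toReal_le_of_le_ofReal hε.le (le_trans (le_of_eq (eLpNorm_congr_ae ?_)) h1)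
  filter_upwards [Lp.coeFn_sub u (restr μ hA u), restr_ae μ hA u] with x h2 h3
  rw [h2, Pi.sub_apply, h3]
  by_cases hx : x ∈ A
  · simp [hx]
  · by_cases hu : u x = 0 <;> simp [hx, hu]

end Restriction

section Phase

variable {Z : Type*} [MeasurableSpace Z] (σ : Measure Z)

/-- A bounded density that turns a given function into its absolute value. -/
theorem exists_linf_mul_eq_norm {w : Z → ℂ} (hw : AEStronglyMeasurable w σ) :
    ∃ k : Lp ℂ ∞ σ, ∀ᵐ z ∂σ, k z * w z = (‖w z‖ : ℂ) := by
  have hm : AEStronglyMeasurable (fun z => star (w z) * ((‖w z‖⁻¹ : ℝ) : ℂ)) σ := by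
    refine hw.star.mul ?_
    exact (Complex.measurable_ofReal.comp_aemeasurable
      (hw.norm.aemeasurable.inv)).aestronglyMeasurable
  have hb : ∀ z, ‖star (w z) * ((‖w z‖⁻¹ : ℝ) : ℂ)‖ ≤ 1 := fun z => by
    rw [norm_mul, norm_star, Complex.norm_real, norm_inv, norm_norm]
    exact mul_inv_le_one
  have hL : MemLp (fun z => star (w z) * ((‖w z‖⁻¹ : ℝ) : ℂ)) ∞ σ :=
    memLp_top_of_bound hm 1 (ae_of_all _ hb)
  refine ⟨hL.toLp _, ?_⟩
  filter_upwards [hL.coeFn_toLp] with z hz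
  rw [hz]
  by_cases h0 : w z = 0
  · simp [h0]
  · have h1 : (‖w z‖ : ℂ) ≠ 0 := by simpa using h0
    rw [mul_right_comm, Complex.star_def, Complex.conj_mul', Complex.ofReal_inv]
    field_simp

end Phase

variable {X Y : Type*} [TopologicalSpace X] [CompactSpace X] [MeasurableSpace X] [BorelSpace X]
  [TopologicalSpace Y] [CompactSpace Y] [MeasurableSpace Y] [BorelSpace Y]
  (μ : Measure X) (ν : Measure Y)

/-- If `v` is orthogonal to `K_F u`, then no measure with dominated images lives on the part of
`null(F)` where `u ⊗ v` does not vanish: a suitable density would give an operator `S` in `K_F`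
with `⟨S u, v⟩ > 0`. -/
theorem measure_eq_zero_of_orthogonal {Z : Type*} [TopologicalSpace Z] [CompactSpace Z]
    [MeasurableSpace Z] [BorelSpace Z] {σ : Measure Z} [IsFiniteMeasure σ] (p : C(Z, X))
    (hp : σ.map p ≤ μ) (q : C(Z, Y)) (hq : σ.map q ≤ ν) (F : Varopoulos X Y)
    (hF : ∀ z, F.1 (p z, q z) = 0) (u : Lp ℂ 2 μ) (v : Lp ℂ 2 ν) (hu : ∀ z, u (p z) ≠ 0)
    (hv : ∀ z, v (q z) ≠ 0) (horth : ∀ S ∈ solutionSpace μ ν F, inner ℂ v (S u) = 0) :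
    σ = 0 := by
  set U := pullback p hp u with hU
  set V := pullback q hq v with hV
  have hint : Integrable (fun z => U z * star (V z)) σ := integrable_mul_star σ U V
  obtain ⟨k, hk⟩ := exists_linf_mul_eq_norm σ hint.aestronglyMeasurable
  have h1 := horth (pairOp p hp q hq k) (mulBy_pairOp_eq_zero p hp q hq F hF k)
  rw [inner_pairOp, L2.inner_def] at h1
  have h2 : ∫ z, ((‖U z * star (V z)‖ : ℝ) : ℂ) ∂σ = 0 := by
    rw [← h1]
    refine integral_congr_ae ?_
    filter_upwards [hk, linfMul_ae σ k U] with z h3 h4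
    rw [← h3, h4, RCLike.inner_apply, starRingEnd_apply]
    ring
  rw [integral_complex_ofReal, Complex.ofReal_eq_zero,
    integral_eq_zero_iff_of_nonneg (fun z => norm_nonneg _) hint.norm] at h2
  rw [← Measure.measure_univ_eq_zero, ← nonpos_iff_eq_zero]
  have h3 : ∀ᵐ z ∂σ, False := by
    filter_upwards [h2, pullback_ae p hp u, pullback_ae q hq v] with z h4 h5 h6
    have h7 : U z * star (V z) = 0 := norm_eq_zero.1 h4
    rw [h5, h6] at h7
    rcases mul_eq_zero.1 h7 with h8 | h8
    · exact hu z h8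
    · exact hv z (star_eq_zero.1 h8)
  exact (measure_mono fun z _ => by simp).trans (ae_iff.1 h3).le

variable [IsFiniteMeasure μ] [IsFiniteMeasure ν]

theorem measure_one_third_lt_le (a : C(X, ℝ)) (ha : 0 ≤ a) :
    μ {x | 1 / 3 < a x} ≤ ENNReal.ofReal (3 * ∫ x, a x ∂μ) := by
  have h1 := mul_meas_ge_le_integral_of_nonneg (ae_of_all μ ha) (integrable_continuousMap μ a)
    (1 / 3)
  change 1 / 3 * (μ {x | 1 / 3 ≤ a x}).toReal ≤ ∫ x, a x ∂μ at h1
  calc μ {x | 1 / 3 < a x} ≤ μ {x | 1 / 3 ≤ a x} := measure_mono fun x (hx : 1 / 3 < a x) => hx.le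
    _ = ENNReal.ofReal (μ {x | 1 / 3 ≤ a x}).toReal :=
      (ENNReal.ofReal_toReal (measure_ne_top _ _)).symm
    _ ≤ _ := ENNReal.ofReal_le_ofReal (by linarith)

/-- Small covers of `null(F) ∩ (K × L)` leave large compact rectangles disjoint from `null(F)`. -/
theorem exists_isCompact_of_orthogonal [T2Space X] [T2Space Y] [μ.Regular] [ν.Regular]
    (F : Varopoulos X Y) (u : Lp ℂ 2 μ) (v : Lp ℂ 2 ν)
    (horth : ∀ S ∈ solutionSpace μ ν F, inner ℂ v (S u) = 0) {δ : ℝ} (hδ : 0 < δ) :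
    ∃ (K : Set X) (L : Set Y), IsCompact K ∧ IsCompact L ∧
      μ ({x | u x ≠ 0} \ K) ≤ ENNReal.ofReal δ ∧ ν ({y | v y ≠ 0} \ L) ≤ ENNReal.ofReal δ ∧
      ∀ x ∈ K, ∀ y ∈ L, (x, y) ∉ nullSet F := by
  have hδ2 : ENNReal.ofReal (δ / 2) ≠ 0 := by simpa using hδ
  obtain ⟨K, hKu, hK, hμK⟩ := (measurableSet_ne_zero μ u).exists_isCompact_sdiff_lt
    (measure_ne_top μ _) hδ2
  obtain ⟨L, hLv, hL, hνL⟩ := (measurableSet_ne_zero ν v).exists_isCompact_sdiff_lt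
    (measure_ne_top ν _) hδ2
  set Z : Set (X × Y) := (K ×ˢ L) ∩ nullSet F with hZ
  have hZc : IsCompact Z :=
    (hK.prod hL).inter_right (isClosed_eq F.1.continuous continuous_const)
  have : CompactSpace Z := isCompact_iff_compactSpace.1 hZc
  -- The product `σ`-algebra of `X × Y` may be too small, so `Z` gets its own Borel structure.
  let _ : MeasurableSpace Z := borel Z
  have : BorelSpace Z := ⟨rfl⟩
  set p : C(Z, X) := ⟨fun z => z.1.1, by fun_prop⟩ with hp
  set q : C(Z, Y) := ⟨fun z => z.1.2, by fun_prop⟩ with hq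
  -- By Markov's inequality, cost `δ / 6` bounds the measures of `{a > 1/3}` and `{b > 1/3}`
  -- by `δ / 2`.
  have hcost : coverCost μ ν p q (fun _ => 1) < δ / 6 := by
    refine lt_of_le_of_lt (not_lt.1 fun hpos => ?_) (by positivity)
    obtain ⟨σ, hσ, hσ0, hσp, hσq⟩ := exists_measure_of_coverCost μ ν p q hpos
    exact hσ0 (measure_eq_zero_of_orthogonal μ ν p hσp q hσq F (fun z => z.2.2) u v
      (fun z => hKu z.2.1.1) (fun z => hLv z.2.1.2) horth)
  obtain ⟨_, ⟨a, b, ha, hb, hab, rfl⟩, hlt⟩ :=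
    exists_lt_of_csInf_lt (coverCosts_nonempty μ ν p q 1) hcost
  have ha0 : 0 ≤ ∫ x, a x ∂μ := integral_nonneg ha
  have hb0 : 0 ≤ ∫ y, b y ∂ν := integral_nonneg hb
  have hadd : ENNReal.ofReal δ = ENNReal.ofReal (δ / 2) + ENNReal.ofReal (δ / 2) := by
    rw [← ENNReal.ofReal_add (by positivity) (by positivity), add_halves]
  refine ⟨K ∩ {x | a x ≤ 1 / 3}, L ∩ {y | b y ≤ 1 / 3},
    hK.inter_right (isClosed_le a.continuous continuous_const),
    hL.inter_right (isClosed_le b.continuous continuous_const), ?_, ?_, ?_⟩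
  · refine (measure_mono (t := ({x | u x ≠ 0} \ K) ∪ {x | 1 / 3 < a x}) fun x hx => ?_).trans
      ((measure_union_le _ _).trans (hadd ▸ add_le_add hμK.le
        ((measure_one_third_lt_le μ a ha).trans (ENNReal.ofReal_le_ofReal (by linarith)))))
    by_cases hxK : x ∈ K
    · exact Or.inr (show 1 / 3 < a x from not_le.1 fun h => hx.2 ⟨hxK, h⟩)
    · exact Or.inl ⟨hx.1, hxK⟩
  · refine (measure_mono (t := ({y | v y ≠ 0} \ L) ∪ {y | 1 / 3 < b y}) fun y hy => ?_).trans
      ((measure_union_le _ _).trans (hadd ▸ add_le_add hνL.le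
        ((measure_one_third_lt_le ν b hb).trans (ENNReal.ofReal_le_ofReal (by linarith)))))
    by_cases hyL : y ∈ L
    · exact Or.inr (show 1 / 3 < b y from not_le.1 fun h => hy.2 ⟨hyL, h⟩)
    · exact Or.inl ⟨hy.1, hyL⟩
  · rintro x ⟨hxK, hxa⟩ y ⟨hyL, hyb⟩ hxy
    have h1 : 1 ≤ a x + b y := hab ⟨(x, y), ⟨hxK, hyL⟩, hxy⟩
    have h2 : a x ≤ 1 / 3 := hxa
    have h3 : b y ≤ 1 / 3 := hyb
    linarith

/-- Approximation of `u` and `v` by their restrictions to compact sets `K` and `L` for which `K × L`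
misses the support of `T`. -/
theorem inner_eq_zero_of_moduleSupp_subset [T2Space X] [T2Space Y] [μ.Regular] [ν.Regular]
    (F : Varopoulos X Y) (T : Lp ℂ 2 μ →L[ℂ] Lp ℂ 2 ν) (hT : moduleSupp T ⊆ nullSet F)
    (u : Lp ℂ 2 μ) (v : Lp ℂ 2 ν) (horth : ∀ S ∈ solutionSpace μ ν F, inner ℂ v (S u) = 0) :
    inner ℂ v (T u) = 0 := by
  have key : ∀ ε : ℝ, 0 < ε → ‖(inner ℂ v (T u) : ℂ)‖ ≤
      ‖v‖ * (‖T‖ * ε) + ε * (‖T‖ * (‖u‖ + ε)) := by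
    intro ε hε
    obtain ⟨δ, hδ, hu⟩ := exists_norm_sub_restr_le μ u hε
    obtain ⟨δ', hδ', hv⟩ := exists_norm_sub_restr_le ν v hε
    obtain ⟨K, L, hK, hL, hμ, hν, hKL⟩ :=
      exists_isCompact_of_orthogonal μ ν F u v horth (lt_min hδ hδ')
    have hu' := hu K hK.measurableSet (hμ.trans (ENNReal.ofReal_le_ofReal (min_le_left _ _)))
    have hv' := hv L hL.measurableSet (hν.trans (ENNReal.ofReal_le_ofReal (min_le_right _ _)))
    set u' := restr μ hK.measurableSet u
    set v' := restr ν hL.measurableSet v with hv'_def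
    have h0 : inner ℂ v' (T u') = 0 := by
      have h1 := compr_eq_zero_of_disjoint_moduleSupp μ ν T hK hL fun x hx y hy h =>
        hKL x hx y hy (hT h)
      have h2 : restr ν hL.measurableSet (T u') = 0 := DFunLike.congr_fun h1 u
      rw [hv'_def, ← inner_restr, h2, inner_zero_right]
    have e : inner ℂ v (T u) = inner ℂ v (T (u - u')) + inner ℂ (v - v') (T u') := by
      rw [map_sub, inner_sub_right, inner_sub_left, h0]
      ring
    have hu1 : ‖u'‖ ≤ ‖u‖ + ε := by
      have := norm_sub_norm_le u' u
      rw [norm_sub_rev] at this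
      linarith
    rw [e]
    refine (norm_add_le _ _).trans (add_le_add ?_ ?_)
    · refine (norm_inner_le_norm _ _).trans (mul_le_mul_of_nonneg_left ?_ (norm_nonneg _))
      exact (T.le_opNorm _).trans (mul_le_mul_of_nonneg_left hu' (norm_nonneg _))
    · refine (norm_inner_le_norm _ _).trans (mul_le_mul hv' ?_ (norm_nonneg _) hε.le)
      exact (T.le_opNorm _).trans (mul_le_mul_of_nonneg_left hu1 (norm_nonneg _))
  have hlim : Tendsto (fun ε : ℝ => ‖v‖ * (‖T‖ * ε) + ε * (‖T‖ * (‖u‖ + ε))) (𝓝[>] 0) (𝓝 0) := by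
    have hc : Continuous fun ε : ℝ => ‖v‖ * (‖T‖ * ε) + ε * (‖T‖ * (‖u‖ + ε)) := by fun_prop
    simpa using (hc.tendsto 0).mono_left nhdsWithin_le_nhds
  refine norm_le_zero_iff.1 (ge_of_tendsto hlim ?_)
  filter_upwards [self_mem_nhdsWithin] with ε hε using key ε hε

/-- The reflexive hull of `K_F` consists of the operators supported in the null set of `F`. -/
theorem mem_refHull_iff [T2Space X] [T2Space Y] [μ.Regular] [ν.Regular] (F : Varopoulos X Y)
    (T : Lp ℂ 2 μ →L[ℂ] Lp ℂ 2 ν) :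
    T ∈ refHull (solutionSpace μ ν F) ↔ moduleSupp T ⊆ nullSet F := by
  refine ⟨moduleSupp_subset_of_mem_refHull μ ν F, fun hT u => ?_⟩
  set M : Submodule ℂ (Lp ℂ 2 ν) :=
    (solutionSpace μ ν F).map (ContinuousLinearMap.apply ℂ (Lp ℂ 2 ν) u).toLinearMap with hM
  have hMc : ((fun S : Lp ℂ 2 μ →L[ℂ] Lp ℂ 2 ν => S u) ''
      (solutionSpace μ ν F : Set (Lp ℂ 2 μ →L[ℂ] Lp ℂ 2 ν))) = M := rfl
  rw [hMc, ← Submodule.topologicalClosure_coe, SetLike.mem_coe,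
    ← Submodule.orthogonal_orthogonal_eq_closure, Submodule.mem_orthogonal]
  intro v hv
  refine inner_eq_zero_of_moduleSupp_subset μ ν F T hT u v fun S hS => ?_
  rw [← inner_conj_symm, (Submodule.mem_orthogonal M v).1 hv (S u) ⟨S, hS, rfl⟩, map_zero]

end ReflexiveHull

end

end OpSynth


theorem corollary4p1 {X Y : Type*}
    [TopologicalSpace X] [CompactSpace X] [T2Space X] [MeasurableSpace X] [BorelSpace X]
    [TopologicalSpace Y] [CompactSpace Y] [T2Space Y] [MeasurableSpace Y] [BorelSpace Y]
    (μ : MeasureTheory.Measure X) [MeasureTheory.IsFiniteMeasure μ] [μ.Regular]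
    (ν : MeasureTheory.Measure Y) [MeasureTheory.IsFiniteMeasure ν] [ν.Regular]
    (F : OpSynth.Varopoulos X Y) :
    [OpSynth.IsOperatorSynthetic μ ν F,
      OpSynth.IsReflexive (OpSynth.solutionSpace μ ν F),
      (LinearMap.ker (OpSynth.mulBy μ ν F).toLinearMap : Set _) =
        OpSynth.zeroSpectralSubspace (OpSynth.mulBy μ ν F)].TFAE := by
  have hker : ∀ T, OpSynth.mulBy μ ν F T = 0 → OpSynth.moduleSupp T ⊆ OpSynth.nullSet F :=
    fun T hT => (OpSynth.mem_zeroSpectralSubspace_iff μ ν F T).1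
      (OpSynth.mem_zeroSpectralSubspace_of_apply_eq_zero _ hT)
  tfae_have 1 → 2 := fun h => Set.ext fun T =>
    (OpSynth.mem_refHull_iff μ ν F T).trans ⟨h T, hker T⟩
  tfae_have 2 → 3 := fun h => Set.ext fun T =>
    (Set.ext_iff.1 h T).symm.trans ((OpSynth.mem_refHull_iff μ ν F T).trans
      (OpSynth.mem_zeroSpectralSubspace_iff μ ν F T).symm)
  tfae_have 3 → 1 := fun h T hT =>
    (Set.ext_iff.1 h T).2 ((OpSynth.mem_zeroSpectralSubspace_iff μ ν F T).2 hT)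
  tfae_finish
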